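/- There are absolute constants $C>0$ and $k\in\mathbb N$ such that the following holds. Setting. Let $\mathcal S$ be a finite state space with a Markov reward process: a transition matrix $P$ which is ergodic (irreducible and aperiodic, i.e. some power of $P$ has only positive entries), with stationary distribution $\mu$, rewards $r(s,s')$ with $|r(s,s')|\le r_{\max}$ for all $s,s'\in\mathcal S$, and a discount factor $\gamma\in[0,1)$. Let $d_{\mathrm{mix}}(t)=\sup_{s}\|P^t(s,\cdot)-\mu\|_{TV}$, where $\|p-q\|_{TV}=\sup_{A\subseteq\mathcal S}|p(A)-q(A)|$, and let $\tau_{\mathrm{mix}}=\min\{t\ge1: d_{\mathrm{mix}}(t)\le 1/4\}$. Let $\phi:\mathcal S\to\mathbb R^d$ satisfy $\|\phi(s)\|\le1$ for all $s$ (Euclidean norm), let $V_\theta(s)=\phi(s)^\top\theta$, and let $\|v\|_M^2=\sum_s\mu(s)v(s)^2$. For $z=(s,s')$ put $g(\theta;z)=\bigl(r(s,s')+\gamma\phi(s')^\top\theta-\phi(s)^\top\theta\bigr)\phi(s)$, and let $\bar g(\theta)=\mathbb E_{s\sim\mu,\,s'\sim P(s,\cdot)}[g(\theta;(s,s'))]$.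 Let $\theta^*\in\mathbb R^d$ satisfy $\bar g(\theta^*)=0$, and let $R>0$ with $\|\theta^*\|\le R$. Algorithm. Let $T\ge1$ be an integer, let $s_1,s_2,\dots$ be a Markov chain with transition matrix $P$ and arbitrary initial distribution, and let $J_1,J_2,\dots$ be i.i.d. with $\mathbb P(J_t=j)=2^{-j}$ for $j\ge1$, independent of the chain. Starting from any fixed $\theta_1$ with $\|\theta_1\|\le R$, iteration $t$ uses the next consecutive samples $z_t^{(1)},z_t^{(2)},\dots$ of the transition sequence $z_i=(s_i,s_{i+1})$. With $g_t^j=2^{-j}\sum_{i=1}^{2^j}g(\theta_t;z_t^{(i)})$ it forms the multi-level Monte Carlo estimator $$g_t=g_t^0+\begin{cases}2^{J_t}\bigl(g_t^{J_t}-g_t^{J_t-1}\bigr), & 2^{J_t}\le T,\\ 0,&\text{otherwise,}\end{cases}$$ and updates $$\theta_{t+1}=\Pi_{\{\|\theta\|\le R\}}\bigl(\theta_t+\eta_tg_t\bigr),\qquad \eta_t=\frac{\sqrt2\,R}{\sqrt{\sum_{k=1}^t\|g_k\|^2}},$$ where $\Pi$ is the Euclidean projection (if $g_1=\dots=g_t=0$,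 then $\theta_{t+1}=\theta_t$). It consumes $2^{J_t}$ samples of the sequence $(z_i)$ if $2^{J_t}\le T$, and otherwise $N(J_t)$ samples, for an arbitrary fixed function $N\ge1$ (for instance $N=1$, the one sample that is used, or $N(j)=2^j$). Conclusion. With $G=r_{\max}+2R$ and $\bar\theta_T=\frac1T\sum_{t=1}^T\theta_t$, the variable $\|V_{\theta^*}-V_{\bar\theta_T}\|_M^2$ is integrable and $$\mathbb E\,\|V_{\theta^*}-V_{\bar\theta_T}\|_M^2\ \le\ C\,(1+\log T)^k\,\frac{G\,R\,\sqrt{\tau_{\mathrm{mix}}}}{(1-\gamma)\sqrt T}.$$ -/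

import Mathlib

open MeasureTheory ProbabilityTheory

noncomputable section

namespace MagTD

/-! ### Distance from stationarity and mixing time of a finite Markov chain -/

section Mixing

variable {S : Type*} [Fintype S] [DecidableEq S]

/-- Total variation distance `sup_A |p(A) - q(A)|` of two distributions on a finite set,
given by their mass functions. -/
def tvDist (p q : S → ℝ) : ℝ :=
  ⨆ A : Finset S, |∑ s ∈ A, p s - ∑ s ∈ A, q s|

/-- `μ` is a probability distribution on `S` which is invariant under `P`. -/
def IsStationary (P : Matrix S S ℝ) (μ : S → ℝ) : Prop :=
  μ ∈ stdSimplex ℝ S ∧ Matrix.vecMul μ P = μ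

/-- Distance from stationarity after `t` steps, `sup_s TV(P^t(s, ·), μ)`. -/
def dMix (P : Matrix S S ℝ) (μ : S → ℝ) (t : ℕ) : ℝ :=
  ⨆ s : S, tvDist ((P ^ t) s) μ

/-- `τ_mix(ε)`: the least number `t ≥ 1` of steps with `d_mix(t) ≤ ε`. -/
def mixingTimeAt (P : Matrix S S ℝ) (μ : S → ℝ) (ε : ℝ) : ℕ :=
  sInf {t : ℕ | 1 ≤ t ∧ dMix P μ t ≤ ε}

/-- `τ_mix = τ_mix(1/4)`. -/
def mixingTime (P : Matrix S S ℝ) (μ : S → ℝ) : ℕ :=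
  mixingTimeAt P μ (1 / 4)

end Mixing

/-! ### Markov reward processes and TD semi-gradients -/

/-- A finite Markov reward process: transition matrix, rewards `r s s'` of transitions, and a
discount factor in `[0, 1)`. -/
structure MRP (S : Type*) [Fintype S] [DecidableEq S] where
  P : Matrix S S ℝ
  stochastic : P ∈ Matrix.rowStochastic ℝ S
  r : S → S → ℝ
  γ : ℝ
  γ_nonneg : 0 ≤ γ
  γ_lt_one : γ < 1

/-- The chain is ergodic (irreducible and aperiodic): some power of the transition matrix has
only positive entries. -/
def MRP.Ergodic {S : Type*} [Fintype S] [DecidableEq S] (M : MRP S) : Prop :=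
  M.P.IsPrimitive

/-- The linear value function `V_θ(s) = φ(s)ᵀ θ`. -/
def linValue {S : Type*} {d : ℕ} (φ : S → EuclideanSpace ℝ (Fin d))
    (θ : EuclideanSpace ℝ (Fin d)) (s : S) : ℝ :=
  inner ℝ (φ s) θ

/-- The squared weighted norm `‖v‖²_M = ∑ s, μ(s) v(s)²`, `M = diag(μ)`. -/
def weightedNormSq {S : Type*} [Fintype S] (μ v : S → ℝ) : ℝ :=
  ∑ s, μ s * v s ^ 2

section TD

variable {S : Type*} [Fintype S] [DecidableEq S] {d : ℕ}

/-- The semi-gradient `g(θ; z) = (r + γ φ(s')ᵀθ - φ(s)ᵀθ) φ(s)` at `z = (s, r(s, s'), s')`. -/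
def semiGrad (M : MRP S) (φ : S → EuclideanSpace ℝ (Fin d)) (θ : EuclideanSpace ℝ (Fin d))
    (s s' : S) : EuclideanSpace ℝ (Fin d) :=
  (M.r s s' + M.γ * linValue φ θ s' - linValue φ θ s) • φ s

/-- The steady-state semi-gradient: the expectation of `g(θ; (s, r(s, s'), s'))` for
`s ∼ μ`, `s' ∼ P(s, ·)`. -/
def meanSemiGrad (M : MRP S) (μ : S → ℝ) (φ : S → EuclideanSpace ℝ (Fin d))
    (θ : EuclideanSpace ℝ (Fin d)) : EuclideanSpace ℝ (Fin d) :=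
  ∑ s, ∑ s', (μ s * M.P s s') • semiGrad M φ θ s s'

end TD

/-! ### The multi-level Monte Carlo estimator, the projection and the algorithm -/

section Algorithm

variable {d : ℕ}

/-- The average of the first `2 ^ j` terms of a sequence of vectors. -/
def batchMean (x : ℕ → EuclideanSpace ℝ (Fin d)) (j : ℕ) : EuclideanSpace ℝ (Fin d) :=
  ((2 : ℝ) ^ j)⁻¹ • ∑ i ∈ Finset.range (2 ^ j), x i

/-- The MLMC estimator with horizon `T` and level `j ≥ 1`:
`g⁰ + 2^j (g^j - g^{j-1})` if `2 ^ j ≤ T`, and `g⁰` otherwise. -/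
def mlmc (T : ℕ) (x : ℕ → EuclideanSpace ℝ (Fin d)) (j : ℕ) : EuclideanSpace ℝ (Fin d) :=
  batchMean x 0 +
    if 2 ^ j ≤ T then (2 : ℝ) ^ j • (batchMean x j - batchMean x (j - 1)) else 0

/-- `N j` is an admissible number of chain samples consumed by an iteration whose level is `j`:
it is `2 ^ j` if `2 ^ j ≤ T`. If `2 ^ j > T`, the estimator only looks at one sample, and any
number `N j ≥ 1` of samples may be consumed (so both `N j = 1` and `N j = 2 ^ j` are covered). -/
def IsSampleCount (T : ℕ) (N : ℕ → ℕ) : Prop :=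
  ∀ j, 1 ≤ N j ∧ (2 ^ j ≤ T → N j = 2 ^ j)

/-- The Euclidean projection onto the closed ball of radius `R` about the origin. -/
def projBall (R : ℝ) (x : EuclideanSpace ℝ (Fin d)) : EuclideanSpace ℝ (Fin d) :=
  if ‖x‖ ≤ R then x else (R / ‖x‖) • x

/-- `projBall R x` is a point of the ball at minimal distance from `x`. -/
theorem projBall_isNearest {R : ℝ} (hR : 0 ≤ R) (x : EuclideanSpace ℝ (Fin d)) :
    ‖projBall R x‖ ≤ R ∧
      ∀ y : EuclideanSpace ℝ (Fin d), ‖y‖ ≤ R → ‖x - projBall R x‖ ≤ ‖x - y‖ := by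
  unfold projBall
  split_ifs with h
  · exact ⟨h, fun y _ => by simp⟩
  · have hx : R < ‖x‖ := not_le.mp h
    have hx0 : 0 < ‖x‖ := lt_of_le_of_lt hR hx
    refine ⟨?_, fun y hy => ?_⟩
    · rw [norm_smul, Real.norm_eq_abs, abs_of_nonneg (by positivity),
        div_mul_cancel₀ _ hx0.ne']
    · have h1 : x - (R / ‖x‖) • x = (1 - R / ‖x‖) • x := by rw [sub_smul, one_smul]
      have h2 : 0 ≤ 1 - R / ‖x‖ := by
        rw [sub_nonneg, div_le_one hx0]; exact hx.le
      have h3 : ‖x - (R / ‖x‖) • x‖ = ‖x‖ - R := by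
        rw [h1, norm_smul, Real.norm_eq_abs, abs_of_nonneg h2, sub_mul, one_mul,
          div_mul_cancel₀ _ hx0.ne']
      rw [h3]
      linarith [norm_sub_norm_le x y]

/-- The variables carried from one iteration to the next: the parameter `θ_t`, the running sum
`∑_{k < t} ‖g_k‖²`, and the number of chain samples consumed so far. -/
structure TDState (d : ℕ) where
  θ : EuclideanSpace ℝ (Fin d)
  sumSq : ℝ
  pos : ℕ

variable {S : Type*} [Fintype S] [DecidableEq S]

/-- The gradient estimate `g_t` of an iteration with level `j` started from `st`. Its `i`-th
sample is the transition from `s (pos + i)` to `s (pos + i + 1)` of the trajectory `s`. -/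
def gradEst (M : MRP S) (φ : S → EuclideanSpace ℝ (Fin d)) (T : ℕ) (s : ℕ → S)
    (st : TDState d) (j : ℕ) : EuclideanSpace ℝ (Fin d) :=
  mlmc T (fun i => semiGrad M φ st.θ (s (st.pos + i)) (s (st.pos + i + 1))) j

/-- One iteration with level `j`: `θ_{t+1} = Π(θ_t + η_t g_t)` with
`η_t = √2 R / √(∑_{k ≤ t} ‖g_k‖²)`. -/
def tdStep (M : MRP S) (φ : S → EuclideanSpace ℝ (Fin d)) (R : ℝ) (T : ℕ) (N : ℕ → ℕ)
    (s : ℕ → S) (st : TDState d) (j : ℕ) : TDState d where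
  θ := projBall R
    (st.θ + (√2 * R / √(st.sumSq + ‖gradEst M φ T s st j‖ ^ 2)) • gradEst M φ T s st j)
  sumSq := st.sumSq + ‖gradEst M φ T s st j‖ ^ 2
  pos := st.pos + N j

/-- The state after `t` iterations, started from the parameter `θ₁`, along the trajectory
`s 0, s 1, …` of the chain with levels `J 0, J 1, …`. -/
def tdState (M : MRP S) (φ : S → EuclideanSpace ℝ (Fin d)) (R : ℝ) (T : ℕ) (N : ℕ → ℕ)
    (θ₁ : EuclideanSpace ℝ (Fin d)) (s : ℕ → S) (J : ℕ → ℕ) : ℕ → TDState d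
  | 0 => ⟨θ₁, 0, 0⟩
  | t + 1 => tdStep M φ R T N s (tdState M φ R T N θ₁ s J t) (J t)

/-- The average `(1 / T) ∑ θ_t` of the first `T` parameters (the first of which is `θ₁`). -/
def tdAverage (M : MRP S) (φ : S → EuclideanSpace ℝ (Fin d)) (R : ℝ) (T : ℕ) (N : ℕ → ℕ)
    (θ₁ : EuclideanSpace ℝ (Fin d)) (s : ℕ → S) (J : ℕ → ℕ) : EuclideanSpace ℝ (Fin d) :=
  (T : ℝ)⁻¹ • ∑ t ∈ Finset.range T, (tdState M φ R T N θ₁ s J t).θ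

end Algorithm

/-! ### The random inputs of the algorithm -/

/-- `s` is a time-homogeneous Markov chain with transition matrix `P` (and arbitrary initial
distribution). -/
def IsMarkovChain {S Ω : Type*} [MeasurableSpace S] [MeasurableSpace Ω]
    (P : Matrix S S ℝ) (s : ℕ → Ω → S) (Pr : Measure Ω) : Prop :=
  (∀ i, Measurable (s i)) ∧
    ∀ (n : ℕ) (x : ℕ → S),
      Pr.real {ω | ∀ i ≤ n + 1, s i ω = x i} =
        Pr.real {ω | ∀ i ≤ n, s i ω = x i} * P (x n) (x (n + 1))

/-- The levels `J 0, J 1, …` are independent, and each of them is geometric with parameter `1/2`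
on `{1, 2, …}`. -/
def IsIIDGeomHalf {Ω : Type*} [MeasurableSpace Ω] (J : ℕ → Ω → ℕ) (Pr : Measure Ω) : Prop :=
  (∀ t, Measurable (J t)) ∧ iIndepFun J Pr ∧
    ∀ t j, 1 ≤ j → Pr.real {ω | J t ω = j} = (1 / 2 : ℝ) ^ j

end MagTD

end

namespace MagTD

/-! ### Mixing of finite chains in the `ℓ¹` distance -/

section L1Mixing

variable {S : Type*} [Fintype S]

/-! Write u for the fixed point and v for the difference of the value functions of u and θ. Two
opposing inequalities meet. Stationarity of μ makes the mean semi-gradient a descent direction: (1 -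
γ)‖v‖²_M is at most the inner product of u - θ with the mean semi-gradient at θ
(`one_sub_mul_weightedNormSq_le`). On the other side, AdaGrad-norm has, on every run and for
arbitrary vectors g_t, regret ∑ ⟪g_t, u - θ_t⟫ ≤ 2√2 R √(∑ ‖g_t‖²) (`regret_le`). By convexity of
the error it remains to control, in expectation, the bias and the second moment of g_t.

Let G = rmax + 2R bound the semi-gradients, let D m bound the ℓ¹ distance to μ after m steps, and
let K bound the partial sums of D; here K = 4τ. An average over 2^l transitions has bias of order GK
/ 2^l and mean squared deviation of order G²(1 + K) / 2^l, even when the parameter depends on the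
past of the chain. In the MLMC estimator the factor 2^k cancels the probability of level k. The
expectation therefore telescopes to the top level L = log₂ T, where the bias is of order GK / T
(`abs_integral_inner_runGrad_sub_le`). In the second moment, 4^k from squaring, 2^(-k) from the
probability and 2^(-k) from the deviation cancel, so each of the L levels costs a multiple of G²(1 +
K) (`integral_norm_sq_runGrad_le`). The step size never uses τ; it enters only through these bounds.

An iteration starts at a random time. The levels are independent of the chain, so they are frozen by
Fubini; starting times are then deterministic, and the Markov property at fixed times suffices. The
resulting rate is valid for τ ≤ T; otherwise the diameter of the ball already gives the claim. -/

theorem sum_abs_vecMul_le {Q : Matrix S S ℝ} {c : ℝ} (ρ : S → ℝ)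
    (h : ∀ x, ∑ y, |Q x y| ≤ c) (ν : S → ℝ) (hν : ∑ x, ν x = 0) :
    ∑ y, |Matrix.vecMul ν (fun x y => Q x y + ρ y) y| ≤ c * ∑ x, |ν x| := by
  have h1 : ∀ y, Matrix.vecMul ν (fun x y => Q x y + ρ y) y = ∑ x, ν x * Q x y := by
    intro y
    simp only [Matrix.vecMul, dotProduct, mul_add, Finset.sum_add_distrib, ← Finset.sum_mul, hν,
      zero_mul, add_zero]
  calc ∑ y, |Matrix.vecMul ν (fun x y => Q x y + ρ y) y|
      ≤ ∑ y, ∑ x, |ν x| * |Q x y| := by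
        refine Finset.sum_le_sum fun y _ => ?_
        rw [h1]
        refine (Finset.abs_sum_le_sum_abs _ _).trans (le_of_eq ?_)
        simp [abs_mul]
    _ = ∑ x, |ν x| * ∑ y, |Q x y| := by
        rw [Finset.sum_comm]; simp [Finset.mul_sum]
    _ ≤ ∑ x, |ν x| * c :=
        Finset.sum_le_sum fun x _ => mul_le_mul_of_nonneg_left (h x) (abs_nonneg _)
    _ = c * ∑ x, |ν x| := by rw [← Finset.sum_mul, mul_comm]

/-- Subtracting the same row ρ from every row of Q does not change its action on zero-sum vectors.
This covers both contractions needed: the Doeblin minorization with ρ = εμ, and the mixing time with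
ρ = μ. -/
theorem sum_abs_vecMul_le_of_sub {Q : Matrix S S ℝ} {c : ℝ} (ρ : S → ℝ)
    (h : ∀ x, ∑ y, |Q x y - ρ y| ≤ c) (ν : S → ℝ) (hν : ∑ x, ν x = 0) :
    ∑ y, |Matrix.vecMul ν Q y| ≤ c * ∑ x, |ν x| := by
  have := sum_abs_vecMul_le (Q := fun x y => Q x y - ρ y) ρ h ν hν
  simpa using this

theorem abs_sum_sub_sum_le_tvDist (p q : S → ℝ) (A : Finset S) :
    |∑ s ∈ A, p s - ∑ s ∈ A, q s| ≤ tvDist p q :=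
  le_ciSup (f := fun A : Finset S => |∑ s ∈ A, p s - ∑ s ∈ A, q s|)
    (Set.finite_range _).bddAbove A

theorem tvDist_le_sum_abs (p q : S → ℝ) : tvDist p q ≤ ∑ s, |p s - q s| := by
  refine ciSup_le fun A => ?_
  rw [← Finset.sum_sub_distrib]
  exact (Finset.abs_sum_le_sum_abs _ _).trans
    (Finset.sum_le_sum_of_subset_of_nonneg (Finset.subset_univ _) fun _ _ _ => abs_nonneg _)

/-- The positive and the negative part of p - q are each the discrepancy on one event. -/
theorem sum_abs_le_two_mul_tvDist (p q : S → ℝ) : ∑ s, |p s - q s| ≤ 2 * tvDist p q := by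
  rw [← Finset.sum_filter_add_sum_filter_not Finset.univ (fun s => q s ≤ p s)]
  have h1 : ∑ s with q s ≤ p s, |p s - q s| ≤ tvDist p q := by
    refine le_trans (le_of_eq ?_) ((le_abs_self _).trans
      (abs_sum_sub_sum_le_tvDist p q ({s | q s ≤ p s} : Finset S)))
    rw [← Finset.sum_sub_distrib]
    refine Finset.sum_congr rfl fun s hs => abs_of_nonneg ?_
    simpa using hs
  have h2 : ∑ s with ¬ q s ≤ p s, |p s - q s| ≤ tvDist p q := by
    refine le_trans (le_of_eq ?_) ((neg_le_abs _).trans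
      (abs_sum_sub_sum_le_tvDist p q ({s | ¬ q s ≤ p s} : Finset S)))
    rw [← Finset.sum_sub_distrib, ← Finset.sum_neg_distrib]
    refine Finset.sum_congr rfl fun s hs => abs_of_nonpos ?_
    have : p s < q s := by simpa using hs
    linarith
  linarith

variable [DecidableEq S]

theorem IsStationary.vecMul_pow {P : Matrix S S ℝ} {μ : S → ℝ} (hμ : IsStationary P μ) (m : ℕ) :
    Matrix.vecMul μ (P ^ m) = μ := by
  induction m with
  | zero => simp
  | succ m ih => rw [pow_succ, ← Matrix.vecMul_vecMul, ih, hμ.2]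

theorem pow_add_sub_stationary {P : Matrix S S ℝ} {μ : S → ℝ} (hμ : IsStationary P μ)
    (m n : ℕ) (x y : S) :
    (P ^ (m + n)) x y - μ y = Matrix.vecMul (fun z => (P ^ m) x z - μ z) (P ^ n) y := by
  have h1 : (fun z => (P ^ m) x z - μ z) = (P ^ m) x - μ := rfl
  rw [h1, Matrix.sub_vecMul, Pi.sub_apply, hμ.vecMul_pow, pow_add]
  rfl

theorem sum_pow_sub_stationary {P : Matrix S S ℝ} (hP : P ∈ Matrix.rowStochastic ℝ S)
    {μ : S → ℝ} (hμ : IsStationary P μ) (m : ℕ) (x : S) :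
    ∑ y, ((P ^ m) x y - μ y) = 0 := by
  rw [Finset.sum_sub_distrib, Matrix.sum_row_of_mem_rowStochastic (pow_mem hP m), hμ.1.2, sub_self]

theorem sum_abs_pow_sub_le_two {P : Matrix S S ℝ} (hP : P ∈ Matrix.rowStochastic ℝ S)
    {μ : S → ℝ} (hμ : IsStationary P μ) (m : ℕ) (x : S) :
    ∑ y, |(P ^ m) x y - μ y| ≤ 2 := by
  have hPm := pow_mem hP m
  calc ∑ y, |(P ^ m) x y - μ y| ≤ ∑ y, ((P ^ m) x y + μ y) := by
        refine Finset.sum_le_sum fun y _ => (abs_sub _ _).trans (le_of_eq ?_)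
        rw [abs_of_nonneg (Matrix.nonneg_of_mem_rowStochastic hPm), abs_of_nonneg (hμ.1.1 y)]
    _ = 2 := by
        rw [Finset.sum_add_distrib, Matrix.sum_row_of_mem_rowStochastic hPm, hμ.1.2]; norm_num

/-- If the chain contracts after `n` steps, the distance to stationarity decays geometrically. -/
theorem sum_abs_pow_sub_le_geometric {P : Matrix S S ℝ} (hP : P ∈ Matrix.rowStochastic ℝ S)
    {μ : S → ℝ} (hμ : IsStationary P μ) {n : ℕ} {c : ℝ} (hc : 0 ≤ c)
    (h : ∀ ν : S → ℝ, ∑ x, ν x = 0 → ∑ y, |Matrix.vecMul ν (P ^ n) y| ≤ c * ∑ x, |ν x|)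
    (k r : ℕ) (x : S) : ∑ y, |(P ^ (k * n + r)) x y - μ y| ≤ 2 * c ^ k := by
  induction k with
  | zero => simpa using sum_abs_pow_sub_le_two hP hμ r x
  | succ k ih =>
    have e : (k + 1) * n + r = (k * n + r) + n := by ring
    simp only [e, pow_add_sub_stationary hμ (k * n + r) n]
    refine (h _ (sum_pow_sub_stationary hP hμ _ x)).trans ?_
    calc c * ∑ y, |(P ^ (k * n + r)) x y - μ y| ≤ c * (2 * c ^ k) :=
          mul_le_mul_of_nonneg_left ih hc
      _ = 2 * c ^ (k + 1) := by ring

theorem tvDist_le_dMix (P : Matrix S S ℝ) (μ : S → ℝ) (t : ℕ) (x : S) :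
    tvDist ((P ^ t) x) μ ≤ dMix P μ t :=
  le_ciSup (f := fun x => tvDist ((P ^ t) x) μ) (Set.finite_range _).bddAbove x

/-- Doeblin's argument: if all entries of P^n are at least ε, then they dominate εμ, and P^n
contracts zero-sum vectors by 1 - ε. Existence matters because the infimum of an empty set of
naturals is 0, so `mixingTime` would carry no information. -/
theorem exists_dMix_le [Nonempty S] {P : Matrix S S ℝ} (hP : P ∈ Matrix.rowStochastic ℝ S)
    (hprim : P.IsPrimitive) {μ : S → ℝ} (hμ : IsStationary P μ) {δ : ℝ} (hδ : 0 < δ) :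
    ∃ t, 1 ≤ t ∧ dMix P μ t ≤ δ := by
  obtain ⟨n, hn, hpos⟩ := hprim.exists_pos_pow
  have hPn := pow_mem hP n
  obtain ⟨⟨a, b⟩, hab⟩ := Finite.exists_min (fun z : S × S => (P ^ n) z.1 z.2)
  set ε := (P ^ n) a b with hε
  have hε0 : 0 < ε := hpos a b
  have hε1 : ε ≤ 1 := Matrix.le_one_of_mem_rowStochastic hPn
  have hμ1 : ∀ y, μ y ≤ 1 := fun y => by
    rw [← hμ.1.2]; exact Finset.single_le_sum (fun i _ => hμ.1.1 i) (Finset.mem_univ y)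
  have hcontr : ∀ ν : S → ℝ, ∑ x, ν x = 0 →
      ∑ y, |Matrix.vecMul ν (P ^ n) y| ≤ (1 - ε) * ∑ x, |ν x| := by
    refine sum_abs_vecMul_le_of_sub (fun y => ε * μ y) fun x => le_of_eq ?_
    have : ∀ y, |(P ^ n) x y - ε * μ y| = (P ^ n) x y - ε * μ y := fun y => by
      refine abs_of_nonneg (sub_nonneg.2 ?_)
      have h1 : ε ≤ (P ^ n) x y := hab (x, y)
      nlinarith [hμ1 y, hμ.1.1 y]
    simp only [this]
    rw [Finset.sum_sub_distrib, ← Finset.mul_sum, hμ.1.2,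
      Matrix.sum_row_of_mem_rowStochastic hPn, mul_one]
  obtain ⟨k, hk⟩ := exists_pow_lt_of_lt_one (half_pos hδ) (by linarith : 1 - ε < 1)
  -- The extra step ensures a time of at least 1, as k may be 0.
  refine ⟨k * n + 1, by omega, ciSup_le fun x => (tvDist_le_sum_abs _ _).trans ?_⟩
  have := sum_abs_pow_sub_le_geometric hP hμ (by linarith : 0 ≤ 1 - ε) hcontr k 1 x
  linarith

theorem mixingTime_spec {P : Matrix S S ℝ} (hP : P ∈ Matrix.rowStochastic ℝ S)
    (hprim : P.IsPrimitive) {μ : S → ℝ} (hμ : IsStationary P μ) :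
    1 ≤ mixingTime P μ ∧ dMix P μ (mixingTime P μ) ≤ 1 / 4 := by
  have : Nonempty S := by
    by_contra h
    rw [not_nonempty_iff] at h
    simpa using hμ.1.2
  exact Nat.sInf_mem (exists_dMix_le hP hprim hμ (by norm_num))

/-- Total variation 1/4 is ℓ¹ distance at most 1/2, so each block of τ steps halves the distance. -/
theorem sum_abs_pow_sub_le {P : Matrix S S ℝ} (hP : P ∈ Matrix.rowStochastic ℝ S)
    (hprim : P.IsPrimitive) {μ : S → ℝ} (hμ : IsStationary P μ) (m : ℕ) (x : S) :
    ∑ y, |(P ^ m) x y - μ y| ≤ 2 * (1 / 2) ^ (m / mixingTime P μ) := by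
  obtain ⟨_, h2⟩ := mixingTime_spec hP hprim hμ
  have hcontr : ∀ x, ∑ y, |(P ^ mixingTime P μ) x y - μ y| ≤ 1 / 2 := fun x => by
    linarith [sum_abs_le_two_mul_tvDist ((P ^ mixingTime P μ) x) μ,
      tvDist_le_dMix P μ (mixingTime P μ) x]
  have := sum_abs_pow_sub_le_geometric hP hμ (by norm_num)
    (sum_abs_vecMul_le_of_sub μ hcontr) (m / mixingTime P μ) (m % mixingTime P μ) x
  rwa [Nat.div_add_mod'] at this

/-- Each exponent k occurs τ times, which leaves 2τ times the geometric series with ratio 1/2. -/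
theorem sum_half_pow_div_le {τ : ℕ} (hτ : 1 ≤ τ) (n : ℕ) :
    ∑ m ∈ Finset.range n, 2 * (1 / 2 : ℝ) ^ (m / τ) ≤ 4 * τ := by
  have key : ∀ k : ℕ, ∑ m ∈ Finset.range (k * τ), 2 * (1 / 2 : ℝ) ^ (m / τ)
      = 4 * τ * (1 - (1 / 2) ^ k) := by
    intro k
    induction k with
    | zero => simp
    | succ k ih =>
      rw [add_mul, one_mul, Finset.sum_range_add, ih]
      have : ∀ i ∈ Finset.range τ, 2 * (1 / 2 : ℝ) ^ ((k * τ + i) / τ) = 2 * (1 / 2) ^ k := by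
        intro i hi
        rw [mul_comm k, Nat.mul_add_div hτ, Nat.div_eq_of_lt (Finset.mem_range.1 hi), add_zero]
      rw [Finset.sum_congr rfl this, Finset.sum_const, Finset.card_range, nsmul_eq_mul, pow_succ]
      ring
  calc ∑ m ∈ Finset.range n, 2 * (1 / 2 : ℝ) ^ (m / τ)
      ≤ ∑ m ∈ Finset.range (n * τ), 2 * (1 / 2 : ℝ) ^ (m / τ) :=
        Finset.sum_le_sum_of_subset_of_nonneg
          (Finset.range_mono (Nat.le_mul_of_pos_right n hτ)) fun _ _ _ => by positivity
    _ = 4 * τ * (1 - (1 / 2) ^ n) := key n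
    _ ≤ 4 * τ := by
        have : (0 : ℝ) ≤ (1 / 2) ^ n := by positivity
        nlinarith [(Nat.cast_nonneg τ : (0 : ℝ) ≤ τ)]

end L1Mixing

/-! ### The Markov property for functions of the trajectory -/

section MarkovProperty

variable {S Ω : Type*}

/-- The trajectory which is given by `u` up to time `n` and constant afterwards. -/
def extendPath {S : Type*} {n : ℕ} (u : Fin (n + 1) → S) (i : ℕ) : S :=
  u ⟨min i n, by omega⟩

theorem DependsOn.eq_sum_cylinder [Fintype S] [DecidableEq S] {n : ℕ} {f : (ℕ → S) → ℝ}
    (hf : DependsOn f (Set.Iic n)) (x : ℕ → S) :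
    f x = ∑ u : Fin (n + 1) → S,
      if ∀ i ≤ n, x i = extendPath u i then f (extendPath u) else 0 := by
  rw [Finset.sum_eq_single (fun i : Fin (n + 1) => x i)]
  · have : ∀ i ≤ n, x i = extendPath (fun i : Fin (n + 1) => x i) i := fun i hi => by
      simp [extendPath, min_eq_left hi]
    rw [if_pos this]
    exact hf fun i hi => this i hi
  · intro u _ hu
    refine if_neg fun h => hu (funext fun i => ?_)
    rw [h i (by omega)]
    simp [extendPath, min_eq_left (Nat.lt_succ_iff.1 i.2)]
  · simp

theorem DependsOn.comp_fun₂ {α β γ : Type*} {f : (ℕ → S) → α} {g : (ℕ → S) → β} {n : ℕ}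
    (hf : DependsOn f (Set.Iic n)) (hg : DependsOn g (Set.Iic n)) (φ : α → β → γ) :
    DependsOn (fun x => φ (f x) (g x)) (Set.Iic n) := fun a b hab => by
  simp only [hf hab, hg hab]

variable [MeasurableSpace S] [MeasurableSpace Ω]

theorem DependsOn.measurable_comp {n : ℕ} [Finite S] [DiscreteMeasurableSpace S]
    {s : ℕ → Ω → S} (hs : ∀ i, Measurable (s i)) {E : Type*} [Nonempty E] [MeasurableSpace E]
    {f : (ℕ → S) → E} (hf : DependsOn f (Set.Iic n)) :
    Measurable fun ω => f fun i => s i ω := by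
  obtain ⟨g, rfl⟩ := dependsOn_iff_exists_comp.1 hf
  have hg : Measurable g := measurable_of_countable g
  exact hg.comp (measurable_pi_lambda _ fun i => hs i)

theorem DependsOn.integrable_comp {n : ℕ} [Finite S] [DiscreteMeasurableSpace S]
    {Pr : Measure Ω} [IsFiniteMeasure Pr]
    {s : ℕ → Ω → S} (hs : ∀ i, Measurable (s i)) {f : (ℕ → S) → ℝ}
    (hf : DependsOn f (Set.Iic n)) : Integrable (fun ω => f fun i => s i ω) Pr := by
  have hm := DependsOn.measurable_comp hs hf
  obtain ⟨g, rfl⟩ := dependsOn_iff_exists_comp.1 hf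
  obtain ⟨C, hC⟩ := (Set.finite_range fun u => ‖g u‖).bddAbove
  exact Integrable.of_bound hm.aestronglyMeasurable C (ae_of_all _ fun ω => hC ⟨_, rfl⟩)

variable [Fintype S] [DecidableEq S] [DiscreteMeasurableSpace S] {P : Matrix S S ℝ}
  {s : ℕ → Ω → S} {Pr : Measure Ω} [IsProbabilityMeasure Pr]

/-- `IsMarkovChain` prescribes probabilities of cylinders only. A function of the first n + 1 states
is a finite combination of cylinder indicators, so linearity suffices. -/
theorem IsMarkovChain.integral_mul_indicator (h : IsMarkovChain P s Pr) {n : ℕ}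
    {f : (ℕ → S) → ℝ} (hf : DependsOn f (Set.Iic n)) (y : S) :
    ∫ ω, (f fun i => s i ω) * (if s (n + 1) ω = y then 1 else 0) ∂Pr =
      ∫ ω, (f fun i => s i ω) * P (s n ω) y ∂Pr := by
  have hcyl : ∀ (m : ℕ) (x : ℕ → S), MeasurableSet {ω | ∀ i ≤ m, s i ω = x i} := by
    intro m x
    have : {ω | ∀ i ≤ m, s i ω = x i} = ⋂ i ∈ Set.Iic m, s i ⁻¹' {x i} := by
      ext ω; simp
    rw [this]
    exact MeasurableSet.biInter (Set.to_countable _) fun i _ => h.1 i (measurableSet_singleton _)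
  -- The longer cylinder needs a path equal to u up to time n and to y afterwards; `extendPath u`
  -- would repeat its last state.
  have h1 : ∀ (u : Fin (n + 1) → S) (ω : Ω),
      (if ∀ i ≤ n, s i ω = extendPath u i then f (extendPath u) else 0) *
        (if s (n + 1) ω = y then (1 : ℝ) else 0) =
      f (extendPath u) * Set.indicator
        {ω | ∀ i ≤ n + 1, s i ω = if i ≤ n then extendPath u i else y} 1 ω := by
    intro u ω
    have e : (∀ i ≤ n + 1, s i ω = if i ≤ n then extendPath u i else y) ↔
        (∀ i ≤ n, s i ω = extendPath u i) ∧ s (n + 1) ω = y := by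
      constructor
      · intro H
        refine ⟨fun i hi => ?_, ?_⟩
        · simpa [hi] using H i (by omega)
        · simpa using H (n + 1) le_rfl
      · rintro ⟨H1, H2⟩ i hi
        rcases Nat.lt_or_ge n i with hni | hni
        · obtain rfl : i = n + 1 := by omega
          simpa using H2
        · simpa [hni] using H1 i hni
    simp only [Set.indicator, Set.mem_ofPred_eq, e, Pi.one_apply]
    by_cases c1 : ∀ i ≤ n, s i ω = extendPath u i <;> by_cases c2 : s (n + 1) ω = y <;>
      simp [c1, c2]
  have h2 : ∀ (u : Fin (n + 1) → S) (ω : Ω),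
      (if ∀ i ≤ n, s i ω = extendPath u i then f (extendPath u) * P (extendPath u n) y else 0) =
      f (extendPath u) * P (extendPath u n) y * Set.indicator
        {ω | ∀ i ≤ n, s i ω = extendPath u i} 1 ω := by
    intro u ω
    simp [Set.indicator]
  have hf2 : DependsOn (fun x => f x * P (x n) y) (Set.Iic n) := fun a b hab => by
    simp only [hf hab, hab n Set.self_mem_Iic]
  have e1 : ∀ ω, (f fun i => s i ω) * (if s (n + 1) ω = y then 1 else 0) =
      ∑ u : Fin (n + 1) → S, f (extendPath u) * Set.indicator
        {ω | ∀ i ≤ n + 1, s i ω = if i ≤ n then extendPath u i else y} 1 ω := by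
    intro ω
    rw [DependsOn.eq_sum_cylinder hf, Finset.sum_mul]
    exact Finset.sum_congr rfl fun u _ => h1 u ω
  have e2 : ∀ ω, (f fun i => s i ω) * P (s n ω) y =
      ∑ u : Fin (n + 1) → S, f (extendPath u) * P (extendPath u n) y * Set.indicator
        {ω | ∀ i ≤ n, s i ω = extendPath u i} 1 ω := by
    intro ω
    rw [DependsOn.eq_sum_cylinder hf2 fun i => s i ω]
    exact Finset.sum_congr rfl fun u _ => h2 u ω
  simp only [e1, e2]
  rw [integral_finsetSum, integral_finsetSum]
  · refine Finset.sum_congr rfl fun u _ => ?_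
    rw [integral_const_mul, integral_const_mul, integral_indicator_one (hcyl _ _),
      integral_indicator_one (hcyl _ _), h.2 n]
    have : {ω | ∀ i ≤ n, s i ω = if i ≤ n then extendPath u i else y} =
        {ω | ∀ i ≤ n, s i ω = extendPath u i} := by
      ext ω
      exact forall₂_congr fun i hi => by simp [hi]
    rw [this]
    simp only [le_refl, if_true, Nat.not_succ_le_self, if_false]
    ring
  all_goals
    intro u _
    exact ((integrable_const (1 : ℝ)).indicator (hcyl _ _)).const_mul _

/-- One-step Markov property. -/
theorem IsMarkovChain.integral_succ (h : IsMarkovChain P s Pr) {n : ℕ}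
    {f : (ℕ → S) → S → ℝ} (hf : ∀ y, DependsOn (f · y) (Set.Iic n)) :
    ∫ ω, f (fun i => s i ω) (s (n + 1) ω) ∂Pr =
      ∫ ω, ∑ y, P (s n ω) y * f (fun i => s i ω) y ∂Pr := by
  have e : ∀ ω, f (fun i => s i ω) (s (n + 1) ω) =
      ∑ y, f (fun i => s i ω) y * (if s (n + 1) ω = y then 1 else 0) := by
    intro ω; simp
  simp only [e]
  rw [integral_finsetSum, integral_finsetSum]
  · refine Finset.sum_congr rfl fun y _ => ?_
    rw [h.integral_mul_indicator (hf y)]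
    simp only [mul_comm]
  · intro y _
    have : DependsOn (fun x : ℕ → S => P (x n) y * f x y) (Set.Iic n) := fun a b hab => by
      simp only [hf y hab, hab n Set.self_mem_Iic]
    exact DependsOn.integrable_comp h.1 this
  · intro y _
    have : DependsOn (fun x : ℕ → S => f x y * (if x (n + 1) = y then 1 else 0))
        (Set.Iic (n + 1)) := fun a b hab => by
      simp only [hf y fun i hi => hab i (Set.Iic_subset_Iic.2 n.le_succ hi),
        hab (n + 1) Set.self_mem_Iic]
    exact DependsOn.integrable_comp h.1 this

/-- Markov property over `m` steps. -/
theorem IsMarkovChain.integral_add (h : IsMarkovChain P s Pr) {n : ℕ} (m : ℕ)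
    {f : (ℕ → S) → S → ℝ} (hf : ∀ y, DependsOn (f · y) (Set.Iic n)) :
    ∫ ω, f (fun i => s i ω) (s (n + m) ω) ∂Pr =
      ∫ ω, ∑ y, (P ^ m) (s n ω) y * f (fun i => s i ω) y ∂Pr := by
  induction m generalizing f with
  | zero => simp [Matrix.one_apply]
  | succ m ih =>
    rw [← add_assoc, h.integral_succ (n := n + m) fun y =>
      (hf y).mono (Set.Iic_subset_Iic.2 (Nat.le_add_right n m)),
      ih (f := fun x z => ∑ y, P z y * f x y) fun z a b hab => by simp only [hf _ hab]]
    congr 1; ext ω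
    simp only [pow_succ, Matrix.mul_apply, Finset.sum_mul, Finset.mul_sum]
    rw [Finset.sum_comm]
    simp only [mul_assoc]

/-- Markov property for a transition which is made after `m` further steps. -/
theorem IsMarkovChain.integral_transition (h : IsMarkovChain P s Pr) {n : ℕ} (m : ℕ)
    {f : (ℕ → S) → S → S → ℝ} (hf : ∀ y z, DependsOn (f · y z) (Set.Iic n)) :
    ∫ ω, f (fun i => s i ω) (s (n + m) ω) (s (n + m + 1) ω) ∂Pr =
      ∫ ω, ∑ y, (P ^ m) (s n ω) y * ∑ z, P y z * f (fun i => s i ω) y z ∂Pr := by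
  rw [← h.integral_add m (f := fun x y => ∑ z, P y z * f x y z) fun y a b hab => by
    simp only [hf _ _ hab]]
  exact h.integral_succ (f := fun x z => f x (x (n + m)) z) fun z a b hab => by
    have h1 := hab (n + m) Set.self_mem_Iic
    have h2 := hf (b (n + m)) z fun i hi =>
      hab i (Set.Iic_subset_Iic.2 (Nat.le_add_right n m) hi)
    simpa only [h1] using h2

end MarkovProperty

/-! ### Bias and second moment of averages along the chain -/

section BatchBounds

variable {S : Type*} [Fintype S]

/-- The stationary mean of a function of the transitions. -/
noncomputable def transitionMean {V : Type*} [AddCommGroup V] [Module ℝ V] (P : Matrix S S ℝ)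
    (μ : S → ℝ) (F : S → S → V) : V :=
  ∑ y, ∑ z, (μ y * P y z) • F y z

/-- The deviation of the `i`-th transition after time `p` from its stationary mean. -/
noncomputable def centered {V : Type*} [AddCommGroup V] [Module ℝ V] (P : Matrix S S ℝ)
    (μ : S → ℝ) (F : (ℕ → S) → S → S → V) (p : ℕ) (x : ℕ → S) (i : ℕ) : V :=
  F x (x (p + i)) (x (p + i + 1)) - transitionMean P μ (F x)

variable {V : Type*} [NormedAddCommGroup V] [InnerProductSpace ℝ V] {P : Matrix S S ℝ}
  {μ : S → ℝ} {G : ℝ}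

theorem dependsOn_centered {p i n : ℕ} (hn : p + i + 1 ≤ n) {F : (ℕ → S) → S → S → V}
    (hF : DependsOn F (Set.Iic p)) :
    DependsOn (fun x => centered P μ F p x i) (Set.Iic n) := fun a b hab => by
  have h1 : F a = F b := hF fun j hj => hab j (Set.mem_Iic.2 (le_trans (Set.mem_Iic.1 hj) (by omega)))
  simp only [centered, h1, hab (p + i) (by simp only [Set.mem_Iic]; omega),
    hab (p + i + 1) (by simpa using hn)]

theorem dependsOn_sum_centered {p n : ℕ} {F : (ℕ → S) → S → S → V}
    (hF : DependsOn F (Set.Iic p)) :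
    DependsOn (fun x => ∑ i ∈ Finset.range n, centered P μ F p x i) (Set.Iic (p + n)) :=
  fun a b hab => Finset.sum_congr rfl fun i hi =>
    dependsOn_centered (by have := Finset.mem_range.1 hi; omega) hF hab

variable [DecidableEq S]

theorem norm_transitionMean_le (hP : P ∈ Matrix.rowStochastic ℝ S) (hμ : IsStationary P μ)
    {F : S → S → V} (hG : ∀ y z, ‖F y z‖ ≤ G) : ‖transitionMean P μ F‖ ≤ G := by
  calc ‖transitionMean P μ F‖ ≤ ∑ y, ∑ z, μ y * P y z * G := by
        refine (norm_sum_le _ _).trans (Finset.sum_le_sum fun y _ =>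
          (norm_sum_le _ _).trans (Finset.sum_le_sum fun z _ => ?_))
        have : 0 ≤ μ y * P y z := mul_nonneg (hμ.1.1 y) (Matrix.nonneg_of_mem_rowStochastic hP)
        rw [norm_smul, Real.norm_of_nonneg this]
        exact mul_le_mul_of_nonneg_left (hG y z) this
    _ = G := by
        simp only [← Finset.sum_mul, ← Finset.mul_sum, Matrix.sum_row_of_mem_rowStochastic hP,
          mul_one, hμ.1.2, one_mul]

theorem norm_centered_le (hP : P ∈ Matrix.rowStochastic ℝ S) (hμ : IsStationary P μ)
    {F : (ℕ → S) → S → S → V} (hG : ∀ x y z, ‖F x y z‖ ≤ G) (p : ℕ) (x : ℕ → S) (i : ℕ) :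
    ‖centered P μ F p x i‖ ≤ 2 * G := by
  refine (norm_sub_le _ _).trans ?_
  linarith [hG x (x (p + i)) (x (p + i + 1)), norm_transitionMean_le hP hμ (hG x)]

/-- Averaging over z leaves a function of y bounded by B * G; centering replaces P^m by P^m - μ, so
only the ℓ¹ distance enters. -/
theorem abs_sum_pow_mul_inner_le (hP : P ∈ Matrix.rowStochastic ℝ S)
    {m : ℕ} {δ : ℝ} (x : S) (hδ : ∑ y, |(P ^ m) x y - μ y| ≤ δ) {F : S → S → V}
    (hG : ∀ y z, ‖F y z‖ ≤ G) {w : V} {B : ℝ} (hw : ‖w‖ ≤ B) :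
    |∑ y, (P ^ m) x y * ∑ z, P y z * inner ℝ w (F y z - transitionMean P μ F)|
      ≤ B * G * δ := by
  have hB : 0 ≤ B := (norm_nonneg w).trans hw
  have hG0 : 0 ≤ G := (norm_nonneg _).trans (hG x x)
  set f : S → ℝ := fun y => ∑ z, P y z * inner ℝ w (F y z) with hf
  have hfb : ∀ y, |f y| ≤ B * G := fun y => by
    calc |f y| ≤ ∑ z, P y z * (B * G) := by
          refine (Finset.abs_sum_le_sum_abs _ _).trans (Finset.sum_le_sum fun z _ => ?_)
          rw [abs_mul, abs_of_nonneg (Matrix.nonneg_of_mem_rowStochastic hP)]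
          refine mul_le_mul_of_nonneg_left ?_ (Matrix.nonneg_of_mem_rowStochastic hP)
          exact (abs_real_inner_le_norm _ _).trans
            (mul_le_mul hw (hG y z) (norm_nonneg _) hB)
      _ = B * G := by rw [← Finset.sum_mul, Matrix.sum_row_of_mem_rowStochastic hP, one_mul]
  have hmean : inner ℝ w (transitionMean P μ F) = ∑ y, μ y * f y := by
    simp only [transitionMean, inner_sum, real_inner_smul_right, hf, Finset.mul_sum, mul_assoc]
  have e : ∑ y, (P ^ m) x y * ∑ z, P y z * inner ℝ w (F y z - transitionMean P μ F) =
      ∑ y, ((P ^ m) x y - μ y) * f y := by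
    simp only [inner_sub_right, mul_sub, Finset.sum_sub_distrib, ← Finset.sum_mul,
      Matrix.sum_row_of_mem_rowStochastic hP, one_mul,
      Matrix.sum_row_of_mem_rowStochastic (pow_mem hP m), hmean, sub_mul]
    rfl
  rw [e]
  calc |∑ y, ((P ^ m) x y - μ y) * f y| ≤ ∑ y, |(P ^ m) x y - μ y| * (B * G) := by
        refine (Finset.abs_sum_le_sum_abs _ _).trans (Finset.sum_le_sum fun y _ => ?_)
        rw [abs_mul]
        exact mul_le_mul_of_nonneg_left (hfb y) (abs_nonneg _)
    _ ≤ δ * (B * G) := by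
        rw [← Finset.sum_mul]; exact mul_le_mul_of_nonneg_right hδ (by positivity)
    _ = B * G * δ := by ring

variable {Ω : Type*} [MeasurableSpace S] [DiscreteMeasurableSpace S] [MeasurableSpace Ω]
  {s : ℕ → Ω → S} {Pr : Measure Ω} [IsProbabilityMeasure Pr] {D : ℕ → ℝ} {K : ℝ}

/-- W is known at time n and the transition starts m steps later, so conditioning on the past up to
n leaves a correlation of size D m. -/
theorem abs_integral_inner_centered_le (hP : P ∈ Matrix.rowStochastic ℝ S)
    (h : IsMarkovChain P s Pr) (hD : ∀ m x, ∑ y, |(P ^ m) x y - μ y| ≤ D m)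
    {F : (ℕ → S) → S → S → V} {p : ℕ} (hF : DependsOn F (Set.Iic p))
    (hG : ∀ x y z, ‖F x y z‖ ≤ G) {n m i : ℕ} (hn : n + m = p + i) (hpn : p ≤ n)
    {W : (ℕ → S) → V} (hW : DependsOn W (Set.Iic n)) {B : ℝ} (hB : ∀ x, ‖W x‖ ≤ B) :
    |∫ ω, inner ℝ (W fun i => s i ω) (centered P μ F p (fun i => s i ω) i) ∂Pr|
      ≤ B * G * D m := by
  simp only [centered, ← hn]
  rw [IsMarkovChain.integral_transition h m
    (f := fun x y z => inner ℝ (W x) (F x y z - transitionMean P μ (F x)))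
    fun y z a b hab => by
      simp only [hW hab, hF fun j hj => hab j (le_trans hj hpn)]]
  rw [← Real.norm_eq_abs, ← mul_one (B * G * D m), ← probReal_univ (μ := Pr)]
  refine norm_integral_le_of_norm_le_const (ae_of_all _ fun ω => ?_)
  exact abs_sum_pow_mul_inner_le hP _ (hD m _) (hG _) (hB _)

/-- The new term is correlated with the i-th one only through a gap of n - 1 - i steps, because the
i-th transition is complete at time p + i + 1. The cross terms of one row thus sum to 4G²K. -/
theorem integral_norm_sq_sum_centered_le (hP : P ∈ Matrix.rowStochastic ℝ S)
    (hμ : IsStationary P μ) (h : IsMarkovChain P s Pr)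
    (hD : ∀ m x, ∑ y, |(P ^ m) x y - μ y| ≤ D m)
    (hK : ∀ n, ∑ m ∈ Finset.range n, D m ≤ K)
    {F : (ℕ → S) → S → S → V} {p : ℕ} (hF : DependsOn F (Set.Iic p))
    (hG0 : 0 ≤ G) (hG : ∀ x y z, ‖F x y z‖ ≤ G) (n : ℕ) :
    ∫ ω, ‖∑ i ∈ Finset.range n, centered P μ F p (fun i => s i ω) i‖ ^ 2 ∂Pr
      ≤ n * (4 * G ^ 2 * (1 + K)) := by
  induction n with
  | zero => simp
  | succ n ih =>
    have hX := norm_centered_le hP hμ hG p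
    simp only [Finset.sum_range_succ _ n, norm_add_sq_real, sum_inner, Finset.mul_sum]
    have hc : ∀ i, i ≤ n → DependsOn (fun x => centered P μ F p x i) (Set.Iic (p + n + 1)) :=
      fun i hi => dependsOn_centered (by omega) hF
    have i1 : Integrable (fun ω =>
        ‖∑ i ∈ Finset.range n, centered P μ F p (fun i => s i ω) i‖ ^ 2) Pr :=
      DependsOn.integrable_comp h.1 (n := p + n)
        (f := fun x => ‖∑ i ∈ Finset.range n, centered P μ F p x i‖ ^ 2)
        fun a b hab => by simp only [dependsOn_sum_centered hF hab]
    have i3 : Integrable (fun ω => ‖centered P μ F p (fun i => s i ω) n‖ ^ 2) Pr :=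
      DependsOn.integrable_comp h.1 (f := fun x => ‖centered P μ F p x n‖ ^ 2)
        (DependsOn.comp_fun₂ (hc n le_rfl) (hc n le_rfl) fun u _ => ‖u‖ ^ 2)
    have i2 : ∀ i ∈ Finset.range n, Integrable (fun ω =>
        2 * inner ℝ (centered P μ F p (fun i => s i ω) i)
          (centered P μ F p (fun i => s i ω) n)) Pr := fun i hi =>
      DependsOn.integrable_comp h.1
        (f := fun x => 2 * inner ℝ (centered P μ F p x i) (centered P μ F p x n))
        (DependsOn.comp_fun₂ (hc i (Finset.mem_range.1 hi).le) (hc n le_rfl)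
          fun u v => 2 * inner ℝ u v)
    rw [integral_add (by exact i1.add (integrable_finsetSum _ i2)) i3,
      integral_add i1 (integrable_finsetSum _ i2), integral_finsetSum _ i2]
    have b3 : ∫ ω, ‖centered P μ F p (fun i => s i ω) n‖ ^ 2 ∂Pr ≤ 4 * G ^ 2 := by
      calc _ ≤ ∫ _, 4 * G ^ 2 ∂Pr := by
            refine integral_mono i3 (integrable_const _) fun ω => ?_
            nlinarith [hX (fun i => s i ω) n, norm_nonneg (centered P μ F p (fun i => s i ω) n)]
        _ = 4 * G ^ 2 := by simp
    have b2 : ∑ i ∈ Finset.range n, ∫ ω, 2 * inner ℝ (centered P μ F p (fun i => s i ω) i)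
        (centered P μ F p (fun i => s i ω) n) ∂Pr ≤ 4 * G ^ 2 * K := by
      calc _ ≤ ∑ i ∈ Finset.range n, 4 * G ^ 2 * D (n - 1 - i) := by
            refine Finset.sum_le_sum fun i hi => ?_
            have hi' := Finset.mem_range.1 hi
            rw [integral_const_mul]
            have := (le_abs_self _).trans (abs_integral_inner_centered_le hP h hD hF hG
              (n := p + i + 1) (m := n - 1 - i) (i := n) (by omega) (by omega)
              (W := fun x => centered P μ F p x i)
              (dependsOn_centered le_rfl hF) fun x => hX x i)
            nlinarith
        _ ≤ 4 * G ^ 2 * K := by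
            rw [← Finset.mul_sum, Finset.sum_range_reflect]
            exact mul_le_mul_of_nonneg_left (hK n) (by positivity)
    push_cast
    linarith

end BatchBounds

/-! ### Averages over batches of dyadic length -/

section BatchMean

variable {S : Type*} {d : ℕ}

/-- The average of `F` over the first `2 ^ l` transitions after time `p`. -/
noncomputable def transitionBatch (F : S → S → EuclideanSpace ℝ (Fin d)) (p : ℕ) (x : ℕ → S)
    (l : ℕ) : EuclideanSpace ℝ (Fin d) :=
  batchMean (fun i => F (x (p + i)) (x (p + i + 1))) l

theorem dependsOn_transitionBatch {F : (ℕ → S) → S → S → EuclideanSpace ℝ (Fin d)} {p l n : ℕ}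
    (hn : p + 2 ^ l ≤ n) (hF : DependsOn F (Set.Iic p)) :
    DependsOn (fun x => transitionBatch (F x) p x l) (Set.Iic n) := fun a b hab => by
  have h2 : 0 < 2 ^ l := by positivity
  have h1 : F a = F b := hF fun j hj => hab j (Set.mem_Iic.2 (le_trans (Set.mem_Iic.1 hj) (by omega)))
  simp only [transitionBatch, batchMean, h1]
  congr 1
  refine Finset.sum_congr rfl fun i hi => ?_
  have := Finset.mem_range.1 hi
  rw [hab (p + i) (by simp only [Set.mem_Iic]; omega),
    hab (p + i + 1) (by simp only [Set.mem_Iic]; omega)]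

variable [Fintype S] {P : Matrix S S ℝ} {μ : S → ℝ}

theorem transitionBatch_sub_transitionMean
    (F : (ℕ → S) → S → S → EuclideanSpace ℝ (Fin d)) (p : ℕ) (x : ℕ → S) (l : ℕ) :
    transitionBatch (F x) p x l - transitionMean P μ (F x) =
      ((2 : ℝ) ^ l)⁻¹ • ∑ i ∈ Finset.range (2 ^ l), centered P μ F p x i := by
  simp only [transitionBatch, batchMean, centered, Finset.sum_sub_distrib, smul_sub,
    Finset.sum_const, Finset.card_range]
  rw [← Nat.cast_smul_eq_nsmul ℝ, smul_smul]
  simp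

variable [DecidableEq S] {G : ℝ} {Ω : Type*} [MeasurableSpace S] [DiscreteMeasurableSpace S]
  [MeasurableSpace Ω] {s : ℕ → Ω → S} {Pr : Measure Ω} [IsProbabilityMeasure Pr]
  {D : ℕ → ℝ} {K : ℝ}

theorem integral_norm_sq_transitionBatch_sub_le (hP : P ∈ Matrix.rowStochastic ℝ S)
    (hμ : IsStationary P μ) (h : IsMarkovChain P s Pr)
    (hD : ∀ m x, ∑ y, |(P ^ m) x y - μ y| ≤ D m)
    (hK : ∀ n, ∑ m ∈ Finset.range n, D m ≤ K)
    {F : (ℕ → S) → S → S → EuclideanSpace ℝ (Fin d)} {p : ℕ} (hF : DependsOn F (Set.Iic p))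
    (hG0 : 0 ≤ G) (hG : ∀ x y z, ‖F x y z‖ ≤ G) (l : ℕ) :
    ∫ ω, ‖transitionBatch (F fun i => s i ω) p (fun i => s i ω) l -
        transitionMean P μ (F fun i => s i ω)‖ ^ 2 ∂Pr ≤ ((2 : ℝ) ^ l)⁻¹ * (4 * G ^ 2 * (1 + K)) := by
  simp only [transitionBatch_sub_transitionMean, norm_smul, mul_pow]
  rw [integral_const_mul]
  have := integral_norm_sq_sum_centered_le hP hμ h hD hK hF hG0 hG (2 ^ l)
  calc _ ≤ ‖((2 : ℝ) ^ l)⁻¹‖ ^ 2 * (((2 ^ l : ℕ) : ℝ) * (4 * G ^ 2 * (1 + K))) :=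
        mul_le_mul_of_nonneg_left this (by positivity)
    _ = _ := by
        rw [Real.norm_of_nonneg (by positivity)]
        push_cast
        field_simp

/-- The chain need not be stationary at time p: the i-th sample has bias governed by D i, and the
total over the batch stays below K whatever its length. -/
theorem abs_integral_inner_transitionBatch_sub_le (hP : P ∈ Matrix.rowStochastic ℝ S)
    (h : IsMarkovChain P s Pr)
    (hD : ∀ m x, ∑ y, |(P ^ m) x y - μ y| ≤ D m)
    (hK : ∀ n, ∑ m ∈ Finset.range n, D m ≤ K)
    {F : (ℕ → S) → S → S → EuclideanSpace ℝ (Fin d)} {p : ℕ} (hF : DependsOn F (Set.Iic p))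
    (hG0 : 0 ≤ G) (hG : ∀ x y z, ‖F x y z‖ ≤ G)
    {W : (ℕ → S) → EuclideanSpace ℝ (Fin d)} (hW : DependsOn W (Set.Iic p)) {B : ℝ}
    (hB0 : 0 ≤ B) (hB : ∀ x, ‖W x‖ ≤ B) (l : ℕ) :
    |∫ ω, inner ℝ (W fun i => s i ω) (transitionBatch (F fun i => s i ω) p (fun i => s i ω) l -
        transitionMean P μ (F fun i => s i ω)) ∂Pr| ≤ ((2 : ℝ) ^ l)⁻¹ * (B * G * K) := by
  simp only [transitionBatch_sub_transitionMean, real_inner_smul_right, inner_sum]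
  rw [integral_const_mul, integral_finsetSum, abs_mul, abs_of_nonneg (by positivity)]
  · refine mul_le_mul_of_nonneg_left ?_ (by positivity)
    calc _ ≤ ∑ i ∈ Finset.range (2 ^ l), B * G * D i := by
          refine (Finset.abs_sum_le_sum_abs _ _).trans (Finset.sum_le_sum fun i _ => ?_)
          exact abs_integral_inner_centered_le hP h hD hF hG rfl le_rfl hW hB
      _ ≤ B * G * K := by
          rw [← Finset.mul_sum]
          exact mul_le_mul_of_nonneg_left (hK _) (by positivity)
  · intro i _
    exact DependsOn.integrable_comp h.1 (n := p + i + 1)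
      (f := fun x => inner ℝ (W x) (centered P μ F p x i)) <|
      DependsOn.comp_fun₂ (hW.mono (Set.Iic_subset_Iic.2 (by omega)))
        (dependsOn_centered le_rfl hF) fun u v => inner ℝ u v

end BatchMean

/-! ### Deterministic analysis of one run -/

section Regret

variable {d : ℕ}

/-- Projecting onto the ball brings a point no farther from any point of the ball. -/
theorem norm_projBall_sub_le {R : ℝ} {y : EuclideanSpace ℝ (Fin d)}
    (hy : ‖y‖ ≤ R) (x : EuclideanSpace ℝ (Fin d)) : ‖projBall R x - y‖ ≤ ‖x - y‖ := by
  unfold projBall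
  split_ifs with h
  · exact le_rfl
  · have hR : 0 ≤ R := (norm_nonneg y).trans hy
    have hx : R < ‖x‖ := not_le.mp h
    have hx0 : 0 < ‖x‖ := hR.trans_lt hx
    refine le_of_sq_le_sq ?_ (norm_nonneg _)
    rw [norm_sub_sq_real, norm_sub_sq_real, norm_smul, real_inner_smul_left,
      Real.norm_of_nonneg (by positivity), div_mul_cancel₀ _ hx0.ne']
    have h1 : inner ℝ x y ≤ ‖x‖ * R :=
      (real_inner_le_norm x y).trans (mul_le_mul_of_nonneg_left hy hx0.le)
    have h2 : (1 - R / ‖x‖) * inner ℝ x y ≤ (1 - R / ‖x‖) * (‖x‖ * R) :=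
      mul_le_mul_of_nonneg_left h1 (by rw [sub_nonneg, div_le_one hx0]; exact hx.le)
    have h3 : (1 - R / ‖x‖) * (‖x‖ * R) = (‖x‖ - R) * R := by field_simp
    nlinarith [sq_nonneg (‖x‖ - R)]

/-- One step of AdaGrad-norm: the instantaneous regret is at most the increase of a potential. -/
theorem adagrad_step {R : ℝ} (hR : 0 < R) {θ u g : EuclideanSpace ℝ (Fin d)} (hθ : ‖θ‖ ≤ R)
    (hu : ‖u‖ ≤ R) {A : ℝ} (hA : 0 ≤ A) :
    inner ℝ g (u - θ) + (2 * (√2 * R) ^ 2 - ‖θ - u‖ ^ 2) * √A / (2 * (√2 * R)) + √2 * R * √A ≤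
      (2 * (√2 * R) ^ 2 -
        ‖projBall R (θ + (√2 * R / √(A + ‖g‖ ^ 2)) • g) - u‖ ^ 2) * √(A + ‖g‖ ^ 2) /
          (2 * (√2 * R)) + √2 * R * √(A + ‖g‖ ^ 2) := by
  -- For g = 0 nothing moves, even if A = 0 and the step size is a division by zero. Otherwise the
  -- new square root is positive.
  rcases eq_or_ne g 0 with rfl | hg
  · simp [projBall, hθ]
  have hg0 : 0 < ‖g‖ := norm_pos_iff.2 hg
  have hR2 : (√2 * R) ^ 2 = 2 * R ^ 2 := by rw [mul_pow, Real.sq_sqrt (by norm_num)]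
  have hc : 0 < √2 * R := by positivity
  have hσ' : 0 < √(A + ‖g‖ ^ 2) := Real.sqrt_pos.2 (by positivity)
  have hσσ : √A ≤ √(A + ‖g‖ ^ 2) := Real.sqrt_le_sqrt (by nlinarith)
  have hsq : √(A + ‖g‖ ^ 2) ^ 2 = √A ^ 2 + ‖g‖ ^ 2 := by
    rw [Real.sq_sqrt (by positivity), Real.sq_sqrt hA]
  have hD : ‖θ - u‖ ^ 2 ≤ 2 * (√2 * R) ^ 2 := by
    have := norm_sub_le θ u
    rw [hR2]
    nlinarith [norm_nonneg (θ - u)]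
  have hproj := norm_projBall_sub_le hu (θ + (√2 * R / √(A + ‖g‖ ^ 2)) • g)
  set c := √2 * R
  set σ := √A
  set σ' := √(A + ‖g‖ ^ 2)
  set w := projBall R (θ + (c / σ') • g)
  have h1 : ‖w - u‖ ^ 2 ≤ ‖θ - u‖ ^ 2 - 2 * (c / σ') * inner ℝ g (u - θ)
      + (c / σ') ^ 2 * ‖g‖ ^ 2 := by
    have e : θ + (c / σ') • g - u = (θ - u) + (c / σ') • g := by abel
    have e2 : inner ℝ (θ - u) g = - inner ℝ g (u - θ) := by
      rw [real_inner_comm, ← inner_neg_right, neg_sub]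
    calc ‖w - u‖ ^ 2 ≤ ‖θ + (c / σ') • g - u‖ ^ 2 := pow_le_pow_left₀ (norm_nonneg _) hproj 2
      _ = _ := by
        rw [e, norm_add_sq_real, real_inner_smul_right, e2, norm_smul, mul_pow,
          Real.norm_of_nonneg (by positivity)]
        ring
  have h2 : 2 * (c / σ') * inner ℝ g (u - θ) ≤ ‖θ - u‖ ^ 2 - ‖w - u‖ ^ 2
      + (c / σ') ^ 2 * ‖g‖ ^ 2 := by linarith
  have h3 : inner ℝ g (u - θ) ≤ (‖θ - u‖ ^ 2 - ‖w - u‖ ^ 2) * σ' / (2 * c)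
      + c * ‖g‖ ^ 2 / (2 * σ') := by
    have : inner ℝ g (u - θ) = (σ' / (2 * c)) * (2 * (c / σ') * inner ℝ g (u - θ)) := by
      field_simp
    rw [this]
    refine (mul_le_mul_of_nonneg_left h2 (by positivity)).trans (le_of_eq ?_)
    field_simp
  -- ‖g‖² = σ'² - σ² = (σ' - σ)(σ' + σ), and σ ≤ σ'.
  have h4 : c * ‖g‖ ^ 2 / (2 * σ') ≤ c * (σ' - σ) := by
    rw [div_le_iff₀ (by positivity)]
    have : ‖g‖ ^ 2 ≤ (σ' - σ) * (2 * σ') := by nlinarith [Real.sqrt_nonneg A]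
    nlinarith
  -- Here 2c² = 4R² is the squared diameter of the ball, so 2c² - ‖θ - u‖² is nonnegative and σ may
  -- be raised to σ'.
  have h5 : (‖θ - u‖ ^ 2 - ‖w - u‖ ^ 2) * σ' / (2 * c) +
      (2 * c ^ 2 - ‖θ - u‖ ^ 2) * σ / (2 * c) ≤ (2 * c ^ 2 - ‖w - u‖ ^ 2) * σ' / (2 * c) := by
    rw [← add_div]
    refine div_le_div_of_nonneg_right ?_ (by positivity)
    nlinarith
  linarith

end Regret

/-! ### Regret along one run -/

section Run

variable {S : Type*} [Fintype S] [DecidableEq S] {d : ℕ} (M : MRP S)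
  (φ : S → EuclideanSpace ℝ (Fin d)) {R : ℝ} (T : ℕ) (N : ℕ → ℕ)
  {θ₁ : EuclideanSpace ℝ (Fin d)} (s : ℕ → S) (J : ℕ → ℕ)

theorem norm_tdState_le (hR : 0 ≤ R) (hθ₁ : ‖θ₁‖ ≤ R) (t : ℕ) :
    ‖(tdState M φ R T N θ₁ s J t).θ‖ ≤ R := by
  cases t with
  | zero => exact hθ₁
  | succ t => exact (projBall_isNearest hR _).1

/-- The gradient estimate of iteration `t`. -/
noncomputable def runGrad (R : ℝ) (θ₁ : EuclideanSpace ℝ (Fin d)) (t : ℕ) :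
    EuclideanSpace ℝ (Fin d) :=
  gradEst M φ T s (tdState M φ R T N θ₁ s J t) (J t)

theorem sumSq_tdState (t : ℕ) : (tdState M φ R T N θ₁ s J t).sumSq =
    ∑ k ∈ Finset.range t, ‖runGrad M φ T N s J R θ₁ k‖ ^ 2 := by
  induction t with
  | zero => rfl
  | succ t ih => rw [Finset.sum_range_succ, ← ih]; rfl

theorem regret_le (hR : 0 < R) (hθ₁ : ‖θ₁‖ ≤ R) {u : EuclideanSpace ℝ (Fin d)} (hu : ‖u‖ ≤ R)
    (t : ℕ) :
    ∑ k ∈ Finset.range t, inner ℝ (runGrad M φ T N s J R θ₁ k)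
        (u - (tdState M φ R T N θ₁ s J k).θ) ≤
      2 * (√2 * R) * √(∑ k ∈ Finset.range t, ‖runGrad M φ T N s J R θ₁ k‖ ^ 2) := by
  rw [← sumSq_tdState]
  have hA : ∀ t, 0 ≤ (tdState M φ R T N θ₁ s J t).sumSq := fun t => by
    rw [sumSq_tdState]; positivity
  have key : ∑ k ∈ Finset.range t, inner ℝ (runGrad M φ T N s J R θ₁ k)
        (u - (tdState M φ R T N θ₁ s J k).θ) ≤
      (2 * (√2 * R) ^ 2 - ‖(tdState M φ R T N θ₁ s J t).θ - u‖ ^ 2) *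
        √(tdState M φ R T N θ₁ s J t).sumSq / (2 * (√2 * R)) +
      √2 * R * √(tdState M φ R T N θ₁ s J t).sumSq := by
    induction t with
    | zero => simp [tdState]
    | succ t ih =>
      rw [Finset.sum_range_succ]
      have := adagrad_step hR (g := runGrad M φ T N s J R θ₁ t)
        (norm_tdState_le M φ T N s J hR.le hθ₁ t) hu (hA t)
      refine le_trans ?_ this
      linarith
  refine key.trans ?_
  -- The final squared distance is dropped, so both halves of the potential are at most √2 R times
  -- the root.
  have h1 : (2 * (√2 * R) ^ 2 - ‖(tdState M φ R T N θ₁ s J t).θ - u‖ ^ 2) *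
      √(tdState M φ R T N θ₁ s J t).sumSq / (2 * (√2 * R)) ≤
      √2 * R * √(tdState M φ R T N θ₁ s J t).sumSq := by
    rw [div_le_iff₀ (by positivity)]
    have := mul_nonneg (sq_nonneg ‖(tdState M φ R T N θ₁ s J t).θ - u‖)
      (Real.sqrt_nonneg (tdState M φ R T N θ₁ s J t).sumSq)
    nlinarith
  linarith

end Run

/-! ### The mean semi-gradient and the weighted norm -/

section MeanPath

variable {S : Type*} [Fintype S] [DecidableEq S] {d : ℕ} {M : MRP S} {μ : S → ℝ}
  {φ : S → EuclideanSpace ℝ (Fin d)}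

theorem norm_semiGrad_le {rmax R : ℝ} (hr : ∀ a b, |M.r a b| ≤ rmax) (hφ : ∀ a, ‖φ a‖ ≤ 1)
    {θ : EuclideanSpace ℝ (Fin d)} (hθ : ‖θ‖ ≤ R) (a b : S) :
    ‖semiGrad M φ θ a b‖ ≤ rmax + 2 * R := by
  have hR : 0 ≤ R := (norm_nonneg θ).trans hθ
  have hv : ∀ a, |linValue φ θ a| ≤ R := fun a => by
    refine (abs_real_inner_le_norm _ _).trans ?_
    nlinarith [hφ a, norm_nonneg (φ a), norm_nonneg θ]
  have h1 : |M.r a b + M.γ * linValue φ θ b - linValue φ θ a| ≤ rmax + 2 * R := by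
    have h2 : |M.γ * linValue φ θ b| ≤ R := by
      rw [abs_mul, abs_of_nonneg M.γ_nonneg]
      nlinarith [hv b, M.γ_lt_one, M.γ_nonneg, abs_nonneg (linValue φ θ b)]
    calc _ ≤ |M.r a b| + |M.γ * linValue φ θ b| + |linValue φ θ a| :=
          (abs_sub _ _).trans (add_le_add_left (abs_add_le _ _) _)
      _ ≤ _ := by linarith [hr a b, hv a]
  rw [semiGrad, norm_smul, Real.norm_eq_abs]
  nlinarith [hφ a, norm_nonneg (φ a), abs_nonneg (M.r a b + M.γ * linValue φ θ b - linValue φ θ a)]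

/-- The mean path of TD learning is a descent direction. -/
theorem one_sub_mul_weightedNormSq_le (hμ : IsStationary M.P μ)
    {u : EuclideanSpace ℝ (Fin d)} (hu : meanSemiGrad M μ φ u = 0)
    (θ : EuclideanSpace ℝ (Fin d)) :
    (1 - M.γ) * weightedNormSq μ (fun a => linValue φ u a - linValue φ θ a) ≤
      inner ℝ (u - θ) (meanSemiGrad M μ φ θ) := by
  set v : S → ℝ := fun a => linValue φ u a - linValue φ θ a with hv
  have hva : ∀ a, inner ℝ (u - θ) (φ a) = v a := fun a => by
    rw [real_inner_comm, inner_sub_right]; rfl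
  have e1 : inner ℝ (u - θ) (meanSemiGrad M μ φ θ) =
      ∑ a, ∑ b, μ a * M.P a b * ((v a - M.γ * v b) * v a) := by
    rw [← sub_zero (meanSemiGrad M μ φ θ), ← hu]
    simp only [meanSemiGrad, semiGrad, ← Finset.sum_sub_distrib, ← smul_sub, ← sub_smul,
      inner_sum, real_inner_smul_right, hva]
    refine Finset.sum_congr rfl fun a _ => Finset.sum_congr rfl fun b _ => ?_
    rw [hv]
    ring
  have e2 : ∑ a, ∑ b, μ a * M.P a b * v a ^ 2 = weightedNormSq μ v := by
    refine Finset.sum_congr rfl fun a _ => ?_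
    rw [← Finset.sum_mul, ← Finset.mul_sum, Matrix.sum_row_of_mem_rowStochastic M.stochastic,
      mul_one]
  -- Stationarity enters here: the successor state again has law μ.
  have e3 : ∑ a, ∑ b, μ a * M.P a b * v b ^ 2 = weightedNormSq μ v := by
    rw [Finset.sum_comm]
    refine Finset.sum_congr rfl fun b _ => ?_
    rw [← Finset.sum_mul]
    congr 1
    exact congrFun hμ.2 b
  rw [e1]
  -- The coefficients 1 - γ/2 and γ/2 come from v(a)v(b) ≤ (v(a)² + v(b)²)/2; termwise the
  -- difference is a multiple of (v(a) - v(b))².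
  calc (1 - M.γ) * weightedNormSq μ v =
        ∑ a, ∑ b, ((1 - M.γ / 2) * (μ a * M.P a b * v a ^ 2)
          - M.γ / 2 * (μ a * M.P a b * v b ^ 2)) := by
        simp only [Finset.sum_sub_distrib, ← Finset.mul_sum, e2, e3]
        ring
    _ ≤ _ := by
        refine Finset.sum_le_sum fun a _ => Finset.sum_le_sum fun b _ => ?_
        have h0 : 0 ≤ μ a * M.P a b :=
          mul_nonneg (hμ.1.1 a) (Matrix.nonneg_of_mem_rowStochastic M.stochastic)
        have := mul_nonneg (mul_nonneg h0 M.γ_nonneg) (sq_nonneg (v a - v b))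
        nlinarith

theorem weightedNormSq_le {R : ℝ} (hμ : IsStationary M.P μ) (hφ : ∀ a, ‖φ a‖ ≤ 1)
    {u θ : EuclideanSpace ℝ (Fin d)} (hu : ‖u‖ ≤ R) (hθ : ‖θ‖ ≤ R) :
    weightedNormSq μ (fun a => linValue φ u a - linValue φ θ a) ≤ 4 * R ^ 2 := by
  have hv : ∀ a, (linValue φ u a - linValue φ θ a) ^ 2 ≤ 4 * R ^ 2 := fun a => by
    have h1 : |linValue φ u a - linValue φ θ a| ≤ 2 * R := by
      rw [linValue, linValue, ← inner_sub_right]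
      refine (abs_real_inner_le_norm _ _).trans ?_
      have := norm_sub_le u θ
      nlinarith [hφ a, norm_nonneg (φ a), norm_nonneg (u - θ)]
    rw [← sq_abs]
    nlinarith [abs_nonneg (linValue φ u a - linValue φ θ a)]
  calc _ ≤ ∑ a, μ a * (4 * R ^ 2) :=
        Finset.sum_le_sum fun a _ => mul_le_mul_of_nonneg_left (hv a) (hμ.1.1 a)
    _ = 4 * R ^ 2 := by rw [← Finset.sum_mul, hμ.1.2, one_mul]

/-- Convexity of the error in the parameter, for uniform averages. -/
theorem weightedNormSq_average_le (hμ : IsStationary M.P μ) {T : ℕ} (hT : 1 ≤ T)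
    (u : EuclideanSpace ℝ (Fin d)) (θ : ℕ → EuclideanSpace ℝ (Fin d)) :
    weightedNormSq μ (fun a => linValue φ u a -
        linValue φ ((T : ℝ)⁻¹ • ∑ t ∈ Finset.range T, θ t) a) ≤
      (T : ℝ)⁻¹ * ∑ t ∈ Finset.range T,
        weightedNormSq μ (fun a => linValue φ u a - linValue φ (θ t) a) := by
  have hT0 : (0 : ℝ) < T := by exact_mod_cast hT
  simp only [weightedNormSq]
  rw [Finset.sum_comm, Finset.mul_sum]
  refine Finset.sum_le_sum fun a _ => ?_
  have e : linValue φ u a - linValue φ ((T : ℝ)⁻¹ • ∑ t ∈ Finset.range T, θ t) a =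
      (T : ℝ)⁻¹ * ∑ t ∈ Finset.range T, (linValue φ u a - linValue φ (θ t) a) := by
    simp only [linValue, real_inner_smul_right, inner_sum, Finset.sum_sub_distrib,
      Finset.sum_const, Finset.card_range, nsmul_eq_mul]
    field_simp
  rw [e, ← Finset.mul_sum, mul_left_comm, mul_pow]
  refine mul_le_mul_of_nonneg_left ?_ (hμ.1.1 a)
  have := sq_sum_le_card_mul_sum_sq (s := Finset.range T)
    (f := fun t => linValue φ u a - linValue φ (θ t) a)
  rw [Finset.card_range] at this
  calc (T : ℝ)⁻¹ ^ 2 * (∑ t ∈ Finset.range T, (linValue φ u a - linValue φ (θ t) a)) ^ 2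
      ≤ (T : ℝ)⁻¹ ^ 2 * (T * ∑ t ∈ Finset.range T, (linValue φ u a - linValue φ (θ t) a) ^ 2) :=
        mul_le_mul_of_nonneg_left this (by positivity)
    _ = _ := by field_simp

end MeanPath

/-! ### Functions of the levels and of the trajectory -/

section LocalFunctions

variable {S : Type*} {E : Type*}

/-- `f` depends only on the first `t` levels and, for fixed levels, on a finite piece of the
trajectory. -/
def IsLocal (t : ℕ) (f : (ℕ → ℕ) → (ℕ → S) → E) : Prop :=
  (∀ x, DependsOn (fun j => f j x) (Set.Iio t)) ∧ ∀ j, ∃ n, DependsOn (f j) (Set.Iic n)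

theorem IsLocal.mono {t t' : ℕ} (h : t ≤ t') {f : (ℕ → ℕ) → (ℕ → S) → E} (hf : IsLocal t f) :
    IsLocal t' f :=
  ⟨fun x => (hf.1 x).mono (Set.Iio_subset_Iio h), hf.2⟩

theorem IsLocal.comp {E' : Type*} {t : ℕ} {f : (ℕ → ℕ) → (ℕ → S) → E} (hf : IsLocal t f)
    (φ : E → E') : IsLocal t fun j x => φ (f j x) :=
  ⟨fun x _ _ hab => congrArg φ (hf.1 x hab), fun j =>
    (hf.2 j).imp fun _ hn _ _ hab => congrArg φ (hn hab)⟩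

theorem IsLocal.comp₂ {E' E'' : Type*} {t : ℕ} {f : (ℕ → ℕ) → (ℕ → S) → E}
    {g : (ℕ → ℕ) → (ℕ → S) → E'} (hf : IsLocal t f) (hg : IsLocal t g) (φ : E → E' → E'') :
    IsLocal t fun j x => φ (f j x) (g j x) := by
  refine ⟨fun x a b hab => ?_, fun j => ?_⟩
  · have h1 : f a x = f b x := hf.1 x hab
    have h2 : g a x = g b x := hg.1 x hab
    simp only [h1, h2]
  · obtain ⟨n, hn⟩ := hf.2 j
    obtain ⟨m, hm⟩ := hg.2 j
    exact ⟨max n m, DependsOn.comp_fun₂ (hn.mono (Set.Iic_subset_Iic.2 (le_max_left _ _)))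
      (hm.mono (Set.Iic_subset_Iic.2 (le_max_right _ _))) φ⟩

theorem IsLocal.finsetSum [AddCommMonoid E] {t : ℕ} {f : ℕ → (ℕ → ℕ) → (ℕ → S) → E} {n : ℕ}
    (hf : ∀ k < n, IsLocal t (f k)) : IsLocal t fun j x => ∑ k ∈ Finset.range n, f k j x := by
  induction n with
  | zero => exact ⟨fun x a b _ => by simp, fun j => ⟨0, fun a b _ => by simp⟩⟩
  | succ n ih =>
    simp only [Finset.sum_range_succ]
    exact (ih fun k hk => hf k (by omega)).comp₂ (hf n (by omega)) (· + ·)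

theorem IsLocal.dependsOn_integral {Ω : Type*} [MeasurableSpace Ω] {Pr : Measure Ω}
    {s : ℕ → Ω → S} {t : ℕ} {f : (ℕ → ℕ) → (ℕ → S) → ℝ} (hf : IsLocal t f) :
    DependsOn (fun j => ∫ ω, f j (fun i => s i ω) ∂Pr) (Set.Iio t) := fun a b hab => by
  have : ∀ x, f a x = f b x := fun x => hf.1 x hab
  simp only [this]

variable [Finite S] [MeasurableSpace S] [DiscreteMeasurableSpace S]

theorem DependsOn.measurable_levels [Nonempty E] [MeasurableSpace E] {t : ℕ}
    {h : (ℕ → ℕ) → E} (hh : DependsOn h (Set.Iio t)) : Measurable h := by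
  obtain ⟨g, rfl⟩ := dependsOn_iff_exists_comp.1 hh
  exact (measurable_of_countable g).comp (measurable_pi_lambda _ fun i => measurable_pi_apply _)

/-- The length of the relevant piece of trajectory need not be bounded uniformly in the levels. But
the first t levels take only countably many values, and for each of them finitely many states
matter. -/
theorem IsLocal.measurable_uncurry [Nonempty E] [MeasurableSpace E] {t : ℕ}
    {f : (ℕ → ℕ) → (ℕ → S) → E} (hf : IsLocal t f) : Measurable (Function.uncurry f) := by
  set ext : (Fin t → ℕ) → ℕ → ℕ := fun u i => if h : i < t then u ⟨i, h⟩ else 0 with hext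
  have e : Function.uncurry f = (fun z : (Fin t → ℕ) × (ℕ → S) => f (ext z.1) z.2) ∘
      fun z : (ℕ → ℕ) × (ℕ → S) => (fun i : Fin t => z.1 i, z.2) := by
    ext ⟨j, x⟩
    exact hf.1 x fun i hi => by simp [hext, Set.mem_Iio.1 hi]
  rw [e]
  have h1 : Measurable fun z : (Fin t → ℕ) × (ℕ → S) => f (ext z.1) z.2 := by
    refine measurable_from_prod_countable_right fun u => ?_
    obtain ⟨n, hn⟩ := hf.2 (ext u)
    exact DependsOn.measurable_comp (s := fun i (x : ℕ → S) => x i)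
      (fun i => measurable_pi_apply i) hn
  exact h1.comp ((measurable_pi_lambda _ fun i =>
    (measurable_pi_apply _).comp measurable_fst).prodMk measurable_snd)

variable {Ω : Type*} [MeasurableSpace Ω] {Pr : Measure Ω} [IsProbabilityMeasure Pr]
  {s : ℕ → Ω → S} {J : ℕ → Ω → ℕ}

theorem IsLocal.integrable {t : ℕ} {f : (ℕ → ℕ) → (ℕ → S) → ℝ} (hf : IsLocal t f) {B : ℝ}
    (hB : ∀ j x, |f j x| ≤ B) (hs : ∀ i, Measurable (s i)) (hJ : ∀ i, Measurable (J i)) :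
    Integrable (fun ω => f (fun t => J t ω) fun i => s i ω) Pr :=
  Integrable.of_bound (hf.measurable_uncurry.comp
    ((measurable_pi_lambda _ hJ).prodMk (measurable_pi_lambda _ hs))).aestronglyMeasurable B
    (ae_of_all _ fun _ => hB _ _)

theorem abs_integral_le_of_abs_le {f : Ω → ℝ} {B : ℝ} (hB : ∀ ω, |f ω| ≤ B) :
    |∫ ω, f ω ∂Pr| ≤ B := by
  rw [← Real.norm_eq_abs, ← mul_one B, ← probReal_univ (μ := Pr)]
  exact norm_integral_le_of_norm_le_const (ae_of_all _ hB)

theorem integrable_levels {t : ℕ} {h : (ℕ → ℕ) → ℝ} (hh : DependsOn h (Set.Iio t)) {B : ℝ}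
    (hB : ∀ j, |h j| ≤ B) (hJ : ∀ i, Measurable (J i)) :
    Integrable (fun ω => h fun t => J t ω) Pr :=
  Integrable.of_bound ((DependsOn.measurable_levels hh).comp
    (measurable_pi_lambda _ hJ)).aestronglyMeasurable B (ae_of_all _ fun _ => hB _)

/-- Integrating out the trajectory first, for fixed levels. -/
theorem IsLocal.integral_eq {t : ℕ} {f : (ℕ → ℕ) → (ℕ → S) → ℝ} (hf : IsLocal t f) {B : ℝ}
    (hB : ∀ j x, |f j x| ≤ B) (hs : ∀ i, Measurable (s i)) (hJ : ∀ i, Measurable (J i))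
    (hind : IndepFun (fun ω t => J t ω) (fun ω i => s i ω) Pr) :
    ∫ ω, f (fun t => J t ω) (fun i => s i ω) ∂Pr =
      ∫ ω', ∫ ω, f (fun t => J t ω') (fun i => s i ω) ∂Pr ∂Pr := by
  have mJ : Measurable fun ω t => J t ω := measurable_pi_lambda _ hJ
  have ms : Measurable fun ω i => s i ω := measurable_pi_lambda _ hs
  have mf := hf.measurable_uncurry
  have := Measure.isProbabilityMeasure_map (μ := Pr) mJ.aemeasurable
  have := Measure.isProbabilityMeasure_map (μ := Pr) ms.aemeasurable
  have hint : Integrable (Function.uncurry f)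
      ((Pr.map fun ω t => J t ω).prod (Pr.map fun ω i => s i ω)) :=
    Integrable.of_bound mf.aestronglyMeasurable B (ae_of_all _ fun z => hB z.1 z.2)
  have h1 : ∫ ω, f (fun t => J t ω) (fun i => s i ω) ∂Pr =
      ∫ z, Function.uncurry f z ∂(Pr.map fun ω => (fun t => J t ω, fun i => s i ω)) :=
    (integral_map (mJ.prodMk ms).aemeasurable mf.aestronglyMeasurable).symm
  rw [h1, hind.map_prod_eq_prod_map_map mJ.aemeasurable ms.aemeasurable, integral_prod _ hint,
    integral_map mJ.aemeasurable hint.integral_prod_left.aestronglyMeasurable]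
  refine integral_congr_ae (ae_of_all _ fun ω' => ?_)
  exact integral_map ms.aemeasurable (mf.comp measurable_prodMk_left).aestronglyMeasurable

end LocalFunctions

/-! ### Independence and law of the levels -/

section Levels

variable {Ω : Type*} [MeasurableSpace Ω] {Pr : Measure Ω} {J : ℕ → Ω → ℕ}

/-- Independence of a level from the earlier ones. -/
theorem IsIIDGeomHalf.integral_ite_mul (h : IsIIDGeomHalf J Pr) {t k : ℕ} (hk : 1 ≤ k)
    {f : (ℕ → ℕ) → ℝ} (hf : DependsOn f (Set.Iio t)) :
    ∫ ω, (if J t ω = k then 1 else 0) * f (fun i => J i ω) ∂Pr =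
      (1 / 2) ^ k * ∫ ω, f (fun i => J i ω) ∂Pr := by
  obtain ⟨hJ, hind, hlaw⟩ := h
  have hf' : DependsOn f (Finset.range t : Set ℕ) := by rwa [Finset.coe_range]
  obtain ⟨g, rfl⟩ := dependsOn_iff_exists_comp.1 hf'
  have h1 := (hind.indepFun_finset {t} (Finset.range t) (by simp) hJ).comp
    (φ := fun u : ({t} : Finset ℕ) → ℕ => if u ⟨t, by simp⟩ = k then (1 : ℝ) else 0)
    (ψ := g) (measurable_of_countable _) (measurable_of_countable _)
  have m1 : Measurable fun ω => if J t ω = k then (1 : ℝ) else 0 :=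
    (measurable_of_countable fun n : ℕ => if n = k then (1 : ℝ) else 0).comp (hJ t)
  have m2 : Measurable fun ω => (g ∘ (Finset.range t : Set ℕ).domRestrict) fun i => J i ω :=
    (measurable_of_countable g).comp (measurable_pi_lambda _ fun i => hJ i)
  refine (h1.integral_fun_mul_eq_mul_integral m1.aestronglyMeasurable
    m2.aestronglyMeasurable).trans ?_
  congr 1
  rw [← hlaw t k hk]
  refine Eq.trans ?_ (integral_indicator_one (hJ t (measurableSet_singleton k)))
  refine integral_congr_ae (ae_of_all _ fun ω => ?_)
  simp [Set.indicator]

theorem IsIIDGeomHalf.integral_ite [IsProbabilityMeasure Pr] (h : IsIIDGeomHalf J Pr) (t : ℕ)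
    {k : ℕ} (hk : 1 ≤ k) :
    ∫ ω, (if J t ω = k then (1 : ℝ) else 0) ∂Pr = (1 / 2) ^ k := by
  simpa using h.integral_ite_mul (t := t) hk (f := fun _ => 1) fun _ _ _ => rfl

end Levels

/-! ### Locality of the algorithm -/

section Locality

variable {S : Type*} [Fintype S] [DecidableEq S] {d : ℕ} (M : MRP S)
  (φ : S → EuclideanSpace ℝ (Fin d)) (R : ℝ) {T : ℕ} {N : ℕ → ℕ}
  (θ₁ : EuclideanSpace ℝ (Fin d))

theorem gradEst_eq (x : ℕ → S) (st : TDState d) (l : ℕ) :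
    gradEst M φ T x st l = transitionBatch (semiGrad M φ st.θ) st.pos x 0 +
      if 2 ^ l ≤ T then (2 : ℝ) ^ l • (transitionBatch (semiGrad M φ st.θ) st.pos x l -
        transitionBatch (semiGrad M φ st.θ) st.pos x (l - 1)) else 0 := rfl

theorem gradEst_congr (hN : IsSampleCount T N) (st : TDState d) (l : ℕ) {x y : ℕ → S}
    (h : ∀ i ≤ st.pos + N l, x i = y i) : gradEst M φ T x st l = gradEst M φ T y st l := by
  have hb : ∀ m, 2 ^ m ≤ N l → transitionBatch (semiGrad M φ st.θ) st.pos x m =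
      transitionBatch (semiGrad M φ st.θ) st.pos y m := fun m hm =>
    dependsOn_transitionBatch (F := fun _ => semiGrad M φ st.θ) (n := st.pos + N l) (by omega)
      (fun _ _ _ => rfl) h
  -- The level-0 average reads one transition even when the level is truncated, which is why N l ≥ 1
  -- is needed.
  rw [gradEst_eq, gradEst_eq, hb 0 (by simpa using (hN l).1)]
  split_ifs with hl
  · have := (hN l).2 hl
    rw [hb l this.ge, hb (l - 1) (this.symm ▸ Nat.pow_le_pow_right (by norm_num) (by omega))]
  · rfl

/-- Sample counts depend on the levels only, so frozen levels make every starting time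
deterministic. -/
theorem pos_tdState (x y : ℕ → S) (j : ℕ → ℕ) (t : ℕ) :
    (tdState M φ R T N θ₁ x j t).pos = (tdState M φ R T N θ₁ y j t).pos := by
  induction t with
  | zero => rfl
  | succ t ih => simp only [tdState, tdStep, ih]

theorem tdState_congr_levels (x : ℕ → S) {j j' : ℕ → ℕ} {t : ℕ} (h : ∀ i < t, j i = j' i) :
    tdState M φ R T N θ₁ x j t = tdState M φ R T N θ₁ x j' t := by
  induction t with
  | zero => rfl
  | succ t ih => rw [tdState, tdState, ih fun i hi => h i (by omega), h t (by omega)]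

theorem tdState_congr_path (hN : IsSampleCount T N) {x y : ℕ → S} {j : ℕ → ℕ} {t : ℕ}
    (h : ∀ i ≤ (tdState M φ R T N θ₁ x j t).pos, x i = y i) :
    tdState M φ R T N θ₁ x j t = tdState M φ R T N θ₁ y j t := by
  induction t with
  | zero => rfl
  | succ t ih =>
    have h' : ∀ i ≤ (tdState M φ R T N θ₁ x j t).pos + N (j t), x i = y i := h
    have e := ih fun i hi => h' i (by omega)
    rw [tdState, tdState, ← e]
    simp only [tdStep, gradEst_congr M φ hN _ _ h']

theorem dependsOn_tdState (hN : IsSampleCount T N) (x₀ : ℕ → S) (j : ℕ → ℕ) (t : ℕ) :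
    DependsOn (fun x => tdState M φ R T N θ₁ x j t)
      (Set.Iic (tdState M φ R T N θ₁ x₀ j t).pos) := fun x y h =>
  tdState_congr_path M φ R θ₁ hN fun i hi => h i (by rwa [pos_tdState M φ R θ₁ x₀ x])

theorem isLocal_tdState [Nonempty S] (hN : IsSampleCount T N) (t : ℕ) :
    IsLocal t fun j x => tdState M φ R T N θ₁ x j t :=
  ⟨fun x _ _ h => tdState_congr_levels M φ R θ₁ x h, fun j =>
    ⟨_, dependsOn_tdState M φ R θ₁ hN (fun _ => Classical.arbitrary S) j t⟩⟩

theorem isLocal_runGrad [Nonempty S] (hN : IsSampleCount T N) (t : ℕ) :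
    IsLocal (t + 1) fun j x => runGrad M φ T N x j R θ₁ t := by
  refine ⟨fun x a b h => ?_, fun j => ⟨(tdState M φ R T N θ₁ (fun _ => Classical.arbitrary S) j t).pos + N (j t),
    fun x y h => ?_⟩⟩
  · have h1 := tdState_congr_levels M φ R (T := T) (N := N) θ₁ x (t := t) fun i hi =>
      h i (Set.mem_Iio.2 (by omega))
    have h2 : a t = b t := h t (Set.mem_Iio.2 (by omega))
    simp only [runGrad, h1, h2]
  · have hp := pos_tdState M φ R (T := T) (N := N) θ₁ x (fun _ => Classical.arbitrary S) j t
    rw [← hp] at h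
    have h1 := tdState_congr_path M φ R θ₁ hN (x := x) (y := y) (j := j) (t := t) fun i hi =>
      h i (Set.mem_Iic.2 (by omega))
    simp only [runGrad]
    rw [← h1]
    exact gradEst_congr M φ hN _ _ h

end Locality

/-! ### Second moment and bias of the gradient estimates of a run -/

section RunBatch

variable {S : Type*} [Fintype S] [DecidableEq S] {d : ℕ} (M : MRP S)
  (φ : S → EuclideanSpace ℝ (Fin d)) (R : ℝ) (T : ℕ) (N : ℕ → ℕ)
  (θ₁ : EuclideanSpace ℝ (Fin d))

/-- The average of the first `2 ^ l` semi-gradients of iteration `t`. -/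
noncomputable def runBatch (t : ℕ) (j : ℕ → ℕ) (x : ℕ → S) (l : ℕ) : EuclideanSpace ℝ (Fin d) :=
  transitionBatch (semiGrad M φ (tdState M φ R T N θ₁ x j t).θ)
    (tdState M φ R T N θ₁ x j t).pos x l

variable {T N}

/-- Splitting over the events of the individual levels makes the estimator linear in their
indicators, ready for independence. -/
theorem runGrad_eq_sum (hT : 1 ≤ T) (t : ℕ) (j : ℕ → ℕ) (x : ℕ → S) :
    runGrad M φ T N x j R θ₁ t = runBatch M φ R T N θ₁ t j x 0 +
      ∑ k ∈ Finset.Icc 1 (Nat.log 2 T), (if j t = k then (1 : ℝ) else 0) • (2 : ℝ) ^ k •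
        (runBatch M φ R T N θ₁ t j x k - runBatch M φ R T N θ₁ t j x (k - 1)) := by
  rw [runGrad, gradEst_eq]
  congr 1
  simp only [ite_smul, one_smul, zero_smul, Finset.sum_ite_eq, Finset.mem_Icc,
    Nat.le_log_iff_pow_le one_lt_two (by omega : T ≠ 0)]
  -- A level 0, which the pathwise statement allows, contributes nothing since 0 - 1 = 0 in ℕ.
  rcases Nat.eq_zero_or_pos (j t) with h | h
  · simp [h]
  · simp only [show 1 ≤ j t from h, true_and]
    rfl

theorem isLocal_runBatch [Nonempty S] (hN : IsSampleCount T N) (t l : ℕ) :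
    IsLocal t fun j x => runBatch M φ R T N θ₁ t j x l := by
  refine ⟨fun x a b h => ?_, fun j =>
    ⟨(tdState M φ R T N θ₁ (fun _ => Classical.arbitrary S) j t).pos + 2 ^ l, fun x y h => ?_⟩⟩
  · have h1 := (isLocal_tdState M φ R θ₁ hN t).1 x h
    simp only [runBatch]
    simp only at h1
    rw [h1]
  · have hp := pos_tdState M φ R (T := T) (N := N) θ₁ x (fun _ => Classical.arbitrary S) j t
    rw [← hp] at h
    have h1 := tdState_congr_path M φ R θ₁ hN (x := x) (y := y) (j := j) (t := t) fun i hi =>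
      h i (Set.mem_Iic.2 (hi.trans (Nat.le_add_right _ _)))
    simp only [runBatch]
    rw [← h1]
    exact dependsOn_transitionBatch (F := fun _ => semiGrad M φ (tdState M φ R T N θ₁ x j t).θ)
      le_rfl (fun _ _ _ => rfl) h

end RunBatch

section RunBounds

variable {S : Type*} [Fintype S] [DecidableEq S] {d : ℕ} {M : MRP S}
  {φ : S → EuclideanSpace ℝ (Fin d)} {R rmax : ℝ} {T : ℕ} {N : ℕ → ℕ}
  {θ₁ : EuclideanSpace ℝ (Fin d)}

theorem norm_batchMean_le {x : ℕ → EuclideanSpace ℝ (Fin d)} {G : ℝ} (hx : ∀ i, ‖x i‖ ≤ G)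
    (l : ℕ) : ‖batchMean x l‖ ≤ G := by
  rw [batchMean, norm_smul, Real.norm_of_nonneg (by positivity), inv_mul_le_iff₀ (by positivity)]
  refine (norm_sum_le _ _).trans ((Finset.sum_le_sum fun i _ => hx i).trans (le_of_eq ?_))
  simp

theorem norm_runBatch_le (hr : ∀ a b, |M.r a b| ≤ rmax) (hφ : ∀ a, ‖φ a‖ ≤ 1) (hR : 0 ≤ R)
    (hθ₁ : ‖θ₁‖ ≤ R) (t : ℕ) (j : ℕ → ℕ) (x : ℕ → S) (l : ℕ) :
    ‖runBatch M φ R T N θ₁ t j x l‖ ≤ rmax + 2 * R :=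
  norm_batchMean_le (fun _ => norm_semiGrad_le hr hφ
    (norm_tdState_le M φ T N x j hR hθ₁ t) _ _) l

/-- Both averages are compared with a common centre w, later the mean semi-gradient, so that the
deviation bounds apply to each. -/
theorem norm_sq_runGrad_le (hT : 1 ≤ T) (hr : ∀ a b, |M.r a b| ≤ rmax) (hφ : ∀ a, ‖φ a‖ ≤ 1)
    (hR : 0 ≤ R) (hθ₁ : ‖θ₁‖ ≤ R) (t : ℕ) (j : ℕ → ℕ) (x : ℕ → S)
    (w : EuclideanSpace ℝ (Fin d)) :
    ‖runGrad M φ T N x j R θ₁ t‖ ^ 2 ≤ 2 * (rmax + 2 * R) ^ 2 +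
      ∑ k ∈ Finset.Icc 1 (Nat.log 2 T), (if j t = k then (1 : ℝ) else 0) * (4 * (2 ^ k) ^ 2 *
        (‖runBatch M φ R T N θ₁ t j x k - w‖ ^ 2 +
          ‖runBatch M φ R T N θ₁ t j x (k - 1) - w‖ ^ 2)) := by
  have sq_add_le : ∀ a b : EuclideanSpace ℝ (Fin d), ‖a + b‖ ^ 2 ≤ 2 * ‖a‖ ^ 2 + 2 * ‖b‖ ^ 2 := by
    intro a b
    nlinarith [norm_add_le a b, norm_nonneg (a + b), sq_nonneg (‖a‖ - ‖b‖)]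
  rw [runGrad_eq_sum M φ R θ₁ hT]
  refine (sq_add_le _ _).trans (add_le_add ?_ ?_)
  · have := norm_runBatch_le (T := T) (N := N) hr hφ hR hθ₁ t j x 0
    nlinarith [norm_nonneg (runBatch M φ R T N θ₁ t j x 0)]
  · simp only [ite_smul, one_smul, zero_smul, ite_mul, one_mul, zero_mul, Finset.sum_ite_eq]
    split_ifs
    · rw [norm_smul, mul_pow, Real.norm_of_nonneg (by positivity)]
      have := sq_add_le (runBatch M φ R T N θ₁ t j x (j t) - w)
        (-(runBatch M φ R T N θ₁ t j x (j t - 1) - w))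
      rw [norm_neg, ← sub_eq_add_neg, sub_sub_sub_cancel_right] at this
      nlinarith [sq_nonneg ((2 : ℝ) ^ j t)]
    · simp

/-- A crude bound, growing with T, that serves only integrability and Fubini. -/
theorem norm_sq_runGrad_le_const (hT : 1 ≤ T) (hr : ∀ a b, |M.r a b| ≤ rmax)
    (hφ : ∀ a, ‖φ a‖ ≤ 1) (hR : 0 ≤ R) (hθ₁ : ‖θ₁‖ ≤ R) (t : ℕ) (j : ℕ → ℕ) (x : ℕ → S) :
    ‖runGrad M φ T N x j R θ₁ t‖ ^ 2 ≤ 2 * (rmax + 2 * R) ^ 2 +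
      ∑ k ∈ Finset.Icc 1 (Nat.log 2 T), (4 * (2 ^ k) ^ 2 *
        ((rmax + 2 * R) ^ 2 + (rmax + 2 * R) ^ 2)) := by
  refine (norm_sq_runGrad_le hT hr hφ hR hθ₁ t j x 0).trans (add_le_add_right
    (Finset.sum_le_sum fun k _ => ?_) _)
  have hb : ∀ l, ‖runBatch M φ R T N θ₁ t j x l - 0‖ ^ 2 ≤ (rmax + 2 * R) ^ 2 := fun l => by
    rw [sub_zero]
    exact pow_le_pow_left₀ (norm_nonneg _) (norm_runBatch_le hr hφ hR hθ₁ t j x l) 2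
  split_ifs
  · rw [one_mul]
    exact mul_le_mul_of_nonneg_left (add_le_add (hb _) (hb _)) (by positivity)
  · rw [zero_mul]; positivity

variable {μ : S → ℝ} [MeasurableSpace S] [DiscreteMeasurableSpace S] {Ω : Type*}
  [MeasurableSpace Ω] {Pr : Measure Ω} [IsProbabilityMeasure Pr] {s : ℕ → Ω → S}
  {D : ℕ → ℝ} {K : ℝ}

theorem integral_norm_sq_runBatch_sub_le (hμ : IsStationary M.P μ)
    (hr : ∀ a b, |M.r a b| ≤ rmax) (hφ : ∀ a, ‖φ a‖ ≤ 1) (hR : 0 ≤ R) (hG : 0 ≤ rmax + 2 * R)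
    (hθ₁ : ‖θ₁‖ ≤ R) (hN : IsSampleCount T N) (hs : IsMarkovChain M.P s Pr)
    (hD : ∀ m x, ∑ y, |(M.P ^ m) x y - μ y| ≤ D m) (hK : ∀ n, ∑ m ∈ Finset.range n, D m ≤ K)
    (t : ℕ) (j : ℕ → ℕ) (l : ℕ) :
    ∫ ω, ‖runBatch M φ R T N θ₁ t j (fun i => s i ω) l -
      meanSemiGrad M μ φ (tdState M φ R T N θ₁ (fun i => s i ω) j t).θ‖ ^ 2 ∂Pr ≤
      ((2 : ℝ) ^ l)⁻¹ * (4 * (rmax + 2 * R) ^ 2 * (1 + K)) := by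
  -- ω₀ merely supplies a reference path by which to name the starting time, which is the same for
  -- all paths.
  obtain ⟨ω₀⟩ := Pr.nonempty_of_neZero
  have hdep := dependsOn_tdState M φ R θ₁ hN (fun i => s i ω₀) j t
  have := integral_norm_sq_transitionBatch_sub_le M.stochastic hμ hs hD hK
    (F := fun x => semiGrad M φ (tdState M φ R T N θ₁ x j t).θ)
    (fun a b hab => congrArg (fun st : TDState d => semiGrad M φ st.θ) (hdep hab)) hG
    (fun x => norm_semiGrad_le hr hφ (norm_tdState_le M φ T N x j hR hθ₁ t)) l
  refine le_trans (le_of_eq ?_) this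
  simp only [runBatch, pos_tdState M φ R (T := T) (N := N) θ₁ _ (fun i => s i ω₀) j t]
  rfl

theorem abs_integral_inner_runBatch_sub_le
    (hr : ∀ a b, |M.r a b| ≤ rmax) (hφ : ∀ a, ‖φ a‖ ≤ 1) (hR : 0 ≤ R) (hG : 0 ≤ rmax + 2 * R)
    (hθ₁ : ‖θ₁‖ ≤ R) (hN : IsSampleCount T N) (hs : IsMarkovChain M.P s Pr)
    (hD : ∀ m x, ∑ y, |(M.P ^ m) x y - μ y| ≤ D m) (hK : ∀ n, ∑ m ∈ Finset.range n, D m ≤ K)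
    {u : EuclideanSpace ℝ (Fin d)} (hu : ‖u‖ ≤ R) (t : ℕ) (j : ℕ → ℕ) (l : ℕ) :
    |∫ ω, inner ℝ (u - (tdState M φ R T N θ₁ (fun i => s i ω) j t).θ)
      (runBatch M φ R T N θ₁ t j (fun i => s i ω) l -
      meanSemiGrad M μ φ (tdState M φ R T N θ₁ (fun i => s i ω) j t).θ) ∂Pr| ≤
      ((2 : ℝ) ^ l)⁻¹ * (2 * R * (rmax + 2 * R) * K) := by
  obtain ⟨ω₀⟩ := Pr.nonempty_of_neZero
  have hdep := dependsOn_tdState M φ R θ₁ hN (fun i => s i ω₀) j t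
  have := abs_integral_inner_transitionBatch_sub_le M.stochastic hs hD hK
    (F := fun x => semiGrad M φ (tdState M φ R T N θ₁ x j t).θ)
    (fun a b hab => congrArg (fun st : TDState d => semiGrad M φ st.θ) (hdep hab)) hG
    (fun x => norm_semiGrad_le hr hφ (norm_tdState_le M φ T N x j hR hθ₁ t))
    (W := fun x => u - (tdState M φ R T N θ₁ x j t).θ)
    (fun a b hab => congrArg (fun st : TDState d => u - st.θ) (hdep hab))
    (by positivity : 0 ≤ 2 * R)
    (fun x => (norm_sub_le _ _).trans (by linarith [norm_tdState_le M φ T N x j hR hθ₁ t])) l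
  refine le_trans (le_of_eq ?_) this
  simp only [runBatch, pos_tdState M φ R (T := T) (N := N) θ₁ _ (fun i => s i ω₀) j t]
  rfl

variable {J : ℕ → Ω → ℕ}

theorem integral_norm_sq_runGrad_le (hμ : IsStationary M.P μ) (hT : 1 ≤ T)
    (hr : ∀ a b, |M.r a b| ≤ rmax) (hφ : ∀ a, ‖φ a‖ ≤ 1) (hR : 0 ≤ R) (hG : 0 ≤ rmax + 2 * R)
    (hθ₁ : ‖θ₁‖ ≤ R) (hN : IsSampleCount T N) (hs : IsMarkovChain M.P s Pr)
    (hJ : IsIIDGeomHalf J Pr) (hind : IndepFun (fun ω t => J t ω) (fun ω i => s i ω) Pr)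
    (hD : ∀ m x, ∑ y, |(M.P ^ m) x y - μ y| ≤ D m) (hK : ∀ n, ∑ m ∈ Finset.range n, D m ≤ K)
    (t : ℕ) :
    ∫ ω, ‖runGrad M φ T N (fun i => s i ω) (fun t => J t ω) R θ₁ t‖ ^ 2 ∂Pr ≤
      2 * (rmax + 2 * R) ^ 2 + Nat.log 2 T * (48 * (rmax + 2 * R) ^ 2 * (1 + K)) := by
  obtain ⟨ω₀⟩ := Pr.nonempty_of_neZero
  have : Nonempty S := ⟨s 0 ω₀⟩
  have hloc : IsLocal (t + 1) fun j x => ‖runGrad M φ T N x j R θ₁ t‖ ^ 2 :=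
    (isLocal_runGrad M φ R θ₁ hN t).comp fun v => ‖v‖ ^ 2
  have hbd := norm_sq_runGrad_le_const (T := T) (N := N) hT hr hφ hR hθ₁ t
  set B := 2 * (rmax + 2 * R) ^ 2 + ∑ k ∈ Finset.Icc 1 (Nat.log 2 T), (4 * ((2 : ℝ) ^ k) ^ 2 *
        ((rmax + 2 * R) ^ 2 + (rmax + 2 * R) ^ 2)) with hB
  have hbd' : ∀ j x, |‖runGrad M φ T N x j R θ₁ t‖ ^ 2| ≤ B := fun j x => by
    rw [abs_of_nonneg (by positivity)]; exact hbd j x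
  set Q := 4 * (rmax + 2 * R) ^ 2 * (1 + K) with hQ
  -- For frozen levels, level k costs 4 · 4^k · (2^(-k) + 2 · 2^(-k)) Q = 12 · 2^k Q; averaging over
  -- the levels then removes the 2^k.
  have hfix : ∀ j : ℕ → ℕ, ∫ ω, ‖runGrad M φ T N (fun i => s i ω) j R θ₁ t‖ ^ 2 ∂Pr ≤
      2 * (rmax + 2 * R) ^ 2 + ∑ k ∈ Finset.Icc 1 (Nat.log 2 T),
        (if j t = k then (1 : ℝ) else 0) * (2 ^ k * (12 * Q)) := by
    intro j
    set m : (ℕ → S) → EuclideanSpace ℝ (Fin d) := fun x =>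
      meanSemiGrad M μ φ (tdState M φ R T N θ₁ x j t).θ with hm
    have hint : ∀ l, Integrable (fun ω =>
        ‖runBatch M φ R T N θ₁ t j (fun i => s i ω) l - m fun i => s i ω‖ ^ 2) Pr := fun l => by
      obtain ⟨n, hn⟩ := ((isLocal_runBatch M φ R θ₁ hN t l).comp₂
        (isLocal_tdState M φ R θ₁ hN t) fun v st => ‖v - meanSemiGrad M μ φ st.θ‖ ^ 2).2 j
      exact DependsOn.integrable_comp hs.1 hn
    have hi2 : ∀ k ∈ Finset.Icc 1 (Nat.log 2 T), Integrable (fun ω =>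
        (if j t = k then (1 : ℝ) else 0) * (4 * (2 ^ k) ^ 2 *
        (‖runBatch M φ R T N θ₁ t j (fun i => s i ω) k - m fun i => s i ω‖ ^ 2 +
          ‖runBatch M φ R T N θ₁ t j (fun i => s i ω) (k - 1) - m fun i => s i ω‖ ^ 2))) Pr :=
      fun k _ => (((hint k).add (hint (k - 1))).const_mul _).const_mul _
    obtain ⟨n, hn⟩ := hloc.2 j
    calc _ ≤ ∫ ω, (2 * (rmax + 2 * R) ^ 2 + ∑ k ∈ Finset.Icc 1 (Nat.log 2 T),
          (if j t = k then (1 : ℝ) else 0) * (4 * (2 ^ k) ^ 2 *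
          (‖runBatch M φ R T N θ₁ t j (fun i => s i ω) k - m fun i => s i ω‖ ^ 2 +
            ‖runBatch M φ R T N θ₁ t j (fun i => s i ω) (k - 1) - m fun i => s i ω‖ ^ 2))) ∂Pr :=
          integral_mono (DependsOn.integrable_comp hs.1 hn)
            ((integrable_const _).add (integrable_finsetSum _ hi2)) fun ω =>
            norm_sq_runGrad_le hT hr hφ hR hθ₁ t j (fun i => s i ω) _
      _ ≤ _ := by
          rw [integral_add (integrable_const _) (integrable_finsetSum _ hi2),
            integral_finsetSum _ hi2]
          simp only [integral_const, probReal_univ, one_smul, integral_const_mul]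
          refine add_le_add_right (Finset.sum_le_sum fun k hk => ?_) _
          refine mul_le_mul_of_nonneg_left ?_ (by positivity)
          rw [integral_add (hint k) (hint (k - 1))]
          have b1 := integral_norm_sq_runBatch_sub_le hμ hr hφ hR hG hθ₁ hN hs hD hK t j k
          have b2 := integral_norm_sq_runBatch_sub_le hμ hr hφ hR hG hθ₁ hN hs hD hK t j (k - 1)
          have hk1 : (2 : ℝ) ^ k = 2 * 2 ^ (k - 1) := by
            rw [← pow_succ', Nat.sub_add_cancel (Finset.mem_Icc.1 hk).1]
          calc 4 * ((2 : ℝ) ^ k) ^ 2 * _ ≤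
              4 * ((2 : ℝ) ^ k) ^ 2 * (((2 : ℝ) ^ k)⁻¹ * Q + ((2 : ℝ) ^ (k - 1))⁻¹ * Q) :=
                mul_le_mul_of_nonneg_left (add_le_add b1 b2) (by positivity)
            _ = 2 ^ k * (12 * Q) := by
                rw [hk1]
                field_simp
                ring
  have hi1 : ∀ k ∈ Finset.Icc 1 (Nat.log 2 T), Integrable (fun ω =>
      (if J t ω = k then (1 : ℝ) else 0) * (2 ^ k * (12 * Q))) Pr := fun k _ => by
    refine Integrable.mul_const (integrable_levels (t := t + 1) (J := J)
      (h := fun j => if j t = k then (1 : ℝ) else 0) (B := 1)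
      (fun a b h => by simp only [h t (Set.mem_Iio.2 t.lt_succ_self)]) (fun j => ?_) hJ.1) _
    split_ifs <;> simp
  calc _ = ∫ ω', ∫ ω, ‖runGrad M φ T N (fun i => s i ω) (fun t => J t ω') R θ₁ t‖ ^ 2 ∂Pr ∂Pr :=
        hloc.integral_eq hbd' hs.1 hJ.1 hind
    _ ≤ ∫ ω', (2 * (rmax + 2 * R) ^ 2 + ∑ k ∈ Finset.Icc 1 (Nat.log 2 T),
        (if J t ω' = k then (1 : ℝ) else 0) * (2 ^ k * (12 * Q))) ∂Pr := by
        refine integral_mono ?_ ((integrable_const _).add (integrable_finsetSum _ hi1))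
          fun ω' => hfix fun t => J t ω'
        exact integrable_levels (B := B) hloc.dependsOn_integral
          (fun j => abs_integral_le_of_abs_le fun ω => hbd' _ _) hJ.1
    _ = 2 * (rmax + 2 * R) ^ 2 + ∑ k ∈ Finset.Icc 1 (Nat.log 2 T), 12 * Q := by
        rw [integral_add (integrable_const _) (integrable_finsetSum _ hi1),
          integral_finsetSum _ hi1]
        simp only [integral_const, probReal_univ, one_smul, integral_mul_const]
        congr 1
        refine Finset.sum_congr rfl fun k hk => ?_
        rw [hJ.integral_ite t (Finset.mem_Icc.1 hk).1, one_div, inv_pow]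
        field_simp
    _ = _ := by
        rw [Finset.sum_const, Nat.card_Icc, Nat.add_sub_cancel, nsmul_eq_mul, hQ]
        ring

theorem abs_integral_inner_runGrad_sub_le (hμ : IsStationary M.P μ) (hT : 1 ≤ T)
    (hr : ∀ a b, |M.r a b| ≤ rmax) (hφ : ∀ a, ‖φ a‖ ≤ 1) (hR : 0 ≤ R) (hG : 0 ≤ rmax + 2 * R)
    (hθ₁ : ‖θ₁‖ ≤ R) (hN : IsSampleCount T N) (hs : IsMarkovChain M.P s Pr)
    (hJ : IsIIDGeomHalf J Pr) (hind : IndepFun (fun ω t => J t ω) (fun ω i => s i ω) Pr)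
    (hD : ∀ m x, ∑ y, |(M.P ^ m) x y - μ y| ≤ D m) (hK : ∀ n, ∑ m ∈ Finset.range n, D m ≤ K)
    {u : EuclideanSpace ℝ (Fin d)} (hu : ‖u‖ ≤ R) (t : ℕ) :
    |∫ ω, inner ℝ (u - (tdState M φ R T N θ₁ (fun i => s i ω) (fun t => J t ω) t).θ)
      (runGrad M φ T N (fun i => s i ω) (fun t => J t ω) R θ₁ t -
      meanSemiGrad M μ φ (tdState M φ R T N θ₁ (fun i => s i ω) (fun t => J t ω) t).θ) ∂Pr| ≤
      4 * R * (rmax + 2 * R) * K / T := by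
  obtain ⟨ω₀⟩ := Pr.nonempty_of_neZero
  have : Nonempty S := ⟨s 0 ω₀⟩
  set G := rmax + 2 * R with hGdef
  set L := Nat.log 2 T with hL
  set f : ℕ → (ℕ → ℕ) → (ℕ → S) → ℝ := fun l j x =>
    inner ℝ (u - (tdState M φ R T N θ₁ x j t).θ) (runBatch M φ R T N θ₁ t j x l -
      meanSemiGrad M μ φ (tdState M φ R T N θ₁ x j t).θ) with hf
  have hloc : ∀ l, IsLocal t (f l) := fun l =>
    (isLocal_runBatch M φ R θ₁ hN t l).comp₂ (isLocal_tdState M φ R θ₁ hN t)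
      fun v st => inner ℝ (u - st.θ) (v - meanSemiGrad M μ φ st.θ)
  have hfb : ∀ l j x, |f l j x| ≤ 2 * R * (2 * G) := fun l j x => by
    have hθ := norm_tdState_le M φ T N x j hR hθ₁ t
    refine (abs_real_inner_le_norm _ _).trans (mul_le_mul ?_ ?_ (norm_nonneg _) (by positivity))
    · exact (norm_sub_le _ _).trans (by linarith)
    · refine (norm_sub_le _ _).trans ?_
      have h1 := norm_runBatch_le (T := T) (N := N) hr hφ hR hθ₁ t j x l
      have h2 : ‖meanSemiGrad M μ φ (tdState M φ R T N θ₁ x j t).θ‖ ≤ G :=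
        norm_transitionMean_le M.stochastic hμ (norm_semiGrad_le hr hφ hθ)
      linarith
  have hfi : ∀ l, Integrable (fun ω => f l (fun t => J t ω) fun i => s i ω) Pr := fun l =>
    (hloc l).integrable (hfb l) hs.1 hJ.1
  -- the mean over the trajectory
  set a : ℕ → (ℕ → ℕ) → ℝ := fun l j => ∫ ω, f l j (fun i => s i ω) ∂Pr with ha
  have hadep : ∀ l, DependsOn (a l) (Set.Iio t) := fun l => (hloc l).dependsOn_integral
  have haE : ∀ l, ∫ ω, f l (fun t => J t ω) (fun i => s i ω) ∂Pr =
      ∫ ω, a l (fun t => J t ω) ∂Pr := fun l => (hloc l).integral_eq (hfb l) hs.1 hJ.1 hind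
  have hite : ∀ l k, 1 ≤ k → IsLocal (t + 1) (fun j x => (if j t = k then 1 else 0) * f l j x) :=
    fun l k _ => by
      have h1 : IsLocal (S := S) (t + 1) fun j _ => if j t = k then (1 : ℝ) else 0 :=
        ⟨fun _ b c h => by simp only [h t (Set.mem_Iio.2 t.lt_succ_self)],
          fun _ => ⟨0, fun _ _ _ => rfl⟩⟩
      exact h1.comp₂ ((hloc l).mono t.le_succ) fun b c => b * c
  have hiteb : ∀ l k j x, |(if j t = k then 1 else 0) * f l j x| ≤ 2 * R * (2 * G) :=
    fun l k j x => by
      rw [abs_mul]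
      have := hfb l j x
      split_ifs <;> simp
      · exact this
      · positivity
  have hiteE : ∀ l k, 1 ≤ k →
      ∫ ω, (if J t ω = k then 1 else 0) * f l (fun t => J t ω) (fun i => s i ω) ∂Pr =
      (1 / 2) ^ k * ∫ ω, f l (fun t => J t ω) (fun i => s i ω) ∂Pr := by
    intro l k hk
    have h1 := (hite l k hk).integral_eq (Pr := Pr) (hiteb l k) hs.1 hJ.1 hind
    have h2 := hJ.integral_ite_mul (t := t) hk (hadep l)
    rw [haE, ← h2]
    refine h1.trans (integral_congr_ae (ae_of_all _ fun ω' => ?_))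
    exact integral_const_mul _ _
  have hitei : ∀ l k, 1 ≤ k → Integrable (fun ω =>
      (if J t ω = k then 1 else 0) * f l (fun t => J t ω) (fun i => s i ω)) Pr := fun l k hk =>
    (hite l k hk).integrable (hiteb l k) hs.1 hJ.1
  have hdecomp : ∀ ω, inner ℝ
      (u - (tdState M φ R T N θ₁ (fun i => s i ω) (fun t => J t ω) t).θ)
      (runGrad M φ T N (fun i => s i ω) (fun t => J t ω) R θ₁ t -
      meanSemiGrad M μ φ (tdState M φ R T N θ₁ (fun i => s i ω) (fun t => J t ω) t).θ) =
      f 0 (fun t => J t ω) (fun i => s i ω) + ∑ k ∈ Finset.Icc 1 L,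
        2 ^ k * ((if J t ω = k then 1 else 0) * f k (fun t => J t ω) (fun i => s i ω) -
          (if J t ω = k then 1 else 0) * f (k - 1) (fun t => J t ω) (fun i => s i ω)) := by
    intro ω
    rw [runGrad_eq_sum M φ R θ₁ hT, add_sub_right_comm, inner_add_right, inner_sum]
    congr 1
    refine Finset.sum_congr rfl fun k _ => ?_
    rw [real_inner_smul_right, real_inner_smul_right, ← mul_sub]
    simp only [hf]
    rw [← inner_sub_right, sub_sub_sub_cancel_right]
    ring
  have hmain : ∫ ω, inner ℝ
      (u - (tdState M φ R T N θ₁ (fun i => s i ω) (fun t => J t ω) t).θ)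
      (runGrad M φ T N (fun i => s i ω) (fun t => J t ω) R θ₁ t -
      meanSemiGrad M μ φ (tdState M φ R T N θ₁ (fun i => s i ω) (fun t => J t ω) t).θ) ∂Pr =
      ∫ ω, a L (fun t => J t ω) ∂Pr := by
    simp only [hdecomp]
    have hi : ∀ k ∈ Finset.Icc 1 L, Integrable (fun ω => (2 : ℝ) ^ k *
        ((if J t ω = k then 1 else 0) * f k (fun t => J t ω) (fun i => s i ω) -
          (if J t ω = k then 1 else 0) * f (k - 1) (fun t => J t ω) (fun i => s i ω))) Pr :=
      fun k hk => ((hitei k k (Finset.mem_Icc.1 hk).1).sub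
        (hitei (k - 1) k (Finset.mem_Icc.1 hk).1)).const_mul _
    rw [integral_add (hfi 0) (integrable_finsetSum _ hi), integral_finsetSum _ hi, ← haE]
    have hk : ∀ k ∈ Finset.Icc 1 L, ∫ ω, (2 : ℝ) ^ k *
        ((if J t ω = k then 1 else 0) * f k (fun t => J t ω) (fun i => s i ω) -
          (if J t ω = k then 1 else 0) * f (k - 1) (fun t => J t ω) (fun i => s i ω)) ∂Pr =
        ∫ ω, f k (fun t => J t ω) (fun i => s i ω) ∂Pr -
          ∫ ω, f (k - 1) (fun t => J t ω) (fun i => s i ω) ∂Pr := by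
      intro k hk
      have hk1 := (Finset.mem_Icc.1 hk).1
      rw [integral_const_mul, integral_sub (hitei k k hk1) (hitei (k - 1) k hk1),
        hiteE k k hk1, hiteE (k - 1) k hk1, ← mul_sub, ← mul_assoc, ← mul_pow]
      norm_num
    rw [Finset.sum_congr rfl hk]
    generalize L = n
    induction n with
    | zero => simp
    | succ n ih =>
      rw [Finset.sum_Icc_succ_top (by omega), ← add_assoc, ih, Nat.add_sub_cancel]
      ring
  rw [hmain]
  have hT0 : (0 : ℝ) < T := by exact_mod_cast hT
  have hK0 : 0 ≤ K := by simpa using hK 0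
  have hpow : ((2 : ℝ) ^ L)⁻¹ ≤ 2 / T := by
    rw [inv_le_iff_one_le_mul₀ (by positivity), div_mul_eq_mul_div, le_div_iff₀ hT0, one_mul]
    have : T < 2 ^ (L + 1) := Nat.lt_pow_succ_log_self (by norm_num) T
    have h2 : (T : ℝ) < 2 ^ (L + 1) := by exact_mod_cast this
    rw [pow_succ'] at h2
    exact h2.le
  calc |∫ ω, a L (fun t => J t ω) ∂Pr| ≤ ((2 : ℝ) ^ L)⁻¹ * (2 * R * G * K) :=
        abs_integral_le_of_abs_le fun ω =>
          abs_integral_inner_runBatch_sub_le hr hφ hR hG hθ₁ hN hs hD hK hu t _ L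
    _ ≤ 2 / T * (2 * R * G * K) := mul_le_mul_of_nonneg_right hpow (by positivity)
    _ = _ := by ring

end RunBounds

/-! ### The error of the averaged parameter -/

section FinalBound

variable {S : Type*} [Fintype S] [DecidableEq S] {d : ℕ} {M : MRP S}
  {φ : S → EuclideanSpace ℝ (Fin d)} {R rmax : ℝ} {T : ℕ} {N : ℕ → ℕ}
  {θ₁ : EuclideanSpace ℝ (Fin d)} {μ : S → ℝ}

theorem isLocal_tdAverage [Nonempty S] (hN : IsSampleCount T N) :
    IsLocal T fun j x => tdAverage M φ R T N θ₁ x j :=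
  (IsLocal.finsetSum fun k hk => ((isLocal_tdState M φ R θ₁ hN k).mono hk.le).comp
    fun st => st.θ).comp fun v => (T : ℝ)⁻¹ • v

theorem norm_tdAverage_le (hT : 1 ≤ T) (hR : 0 ≤ R) (hθ₁ : ‖θ₁‖ ≤ R) (x : ℕ → S) (j : ℕ → ℕ) :
    ‖tdAverage M φ R T N θ₁ x j‖ ≤ R := by
  have hT0 : (0 : ℝ) < T := by exact_mod_cast hT
  rw [tdAverage, norm_smul, Real.norm_of_nonneg (by positivity), inv_mul_le_iff₀ hT0]
  refine (norm_sum_le _ _).trans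
    ((Finset.sum_le_sum fun i _ => norm_tdState_le M φ T N x j hR hθ₁ i).trans (le_of_eq ?_))
  simp

theorem weightedNormSq_nonneg (hμ : IsStationary M.P μ) (v : S → ℝ) : 0 ≤ weightedNormSq μ v :=
  Finset.sum_nonneg fun a _ => mul_nonneg (hμ.1.1 a) (sq_nonneg _)

theorem sqrt_le_half_add {a b : ℝ} (ha : 0 ≤ a) (hb : 0 < b) : √a ≤ (a / b + b) / 2 := by
  have h : a / b * b = a := div_mul_cancel₀ a hb.ne'
  have h1 := Real.sq_sqrt ha
  rw [← mul_le_mul_iff_of_pos_right hb]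
  nlinarith [sq_nonneg (√a - b)]

/-- Regret bound for one run, with the square root of the gradient norms linearized at `b`. -/
theorem one_sub_mul_weightedNormSq_tdAverage_le (hμ : IsStationary M.P μ) (hT : 1 ≤ T)
    (hR : 0 < R) (hθ₁ : ‖θ₁‖ ≤ R) {u : EuclideanSpace ℝ (Fin d)} (hu : ‖u‖ ≤ R)
    (hfix : meanSemiGrad M μ φ u = 0) {b : ℝ} (hb : 0 < b) (x : ℕ → S) (j : ℕ → ℕ) :
    (1 - M.γ) * weightedNormSq μ (fun a => linValue φ u a -
        linValue φ (tdAverage M φ R T N θ₁ x j) a) ≤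
      (T : ℝ)⁻¹ * (√2 * R * ((∑ t ∈ Finset.range T,
          ‖runGrad M φ T N x j R θ₁ t‖ ^ 2) / b + b) -
        ∑ t ∈ Finset.range T, inner ℝ (u - (tdState M φ R T N θ₁ x j t).θ)
          (runGrad M φ T N x j R θ₁ t - meanSemiGrad M μ φ (tdState M φ R T N θ₁ x j t).θ)) := by
  have hγ : 0 ≤ 1 - M.γ := by linarith [M.γ_lt_one]
  have h1 := mul_le_mul_of_nonneg_left (weightedNormSq_average_le (φ := φ) hμ hT u
    fun t => (tdState M φ R T N θ₁ x j t).θ) hγ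
  refine h1.trans ?_
  rw [mul_left_comm, Finset.mul_sum]
  refine mul_le_mul_of_nonneg_left ?_ (by positivity)
  have h2 := regret_le M φ T N x j hR hθ₁ hu T
  have h3 := sqrt_le_half_add (a := ∑ t ∈ Finset.range T, ‖runGrad M φ T N x j R θ₁ t‖ ^ 2)
    (by positivity) hb
  have h4 : 2 * (√2 * R) * √(∑ t ∈ Finset.range T, ‖runGrad M φ T N x j R θ₁ t‖ ^ 2) ≤
      √2 * R * ((∑ t ∈ Finset.range T, ‖runGrad M φ T N x j R θ₁ t‖ ^ 2) / b + b) := by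
    have h5 : 0 < √2 * R := by positivity
    nlinarith
  calc _ ≤ ∑ t ∈ Finset.range T, inner ℝ (u - (tdState M φ R T N θ₁ x j t).θ)
          (meanSemiGrad M μ φ (tdState M φ R T N θ₁ x j t).θ) :=
        Finset.sum_le_sum fun t _ => one_sub_mul_weightedNormSq_le hμ hfix _
    _ = ∑ k ∈ Finset.range T, inner ℝ (runGrad M φ T N x j R θ₁ k)
          (u - (tdState M φ R T N θ₁ x j k).θ) -
        ∑ t ∈ Finset.range T, inner ℝ (u - (tdState M φ R T N θ₁ x j t).θ)
          (runGrad M φ T N x j R θ₁ t -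
            meanSemiGrad M μ φ (tdState M φ R T N θ₁ x j t).θ) := by
        rw [← Finset.sum_sub_distrib]
        refine Finset.sum_congr rfl fun t _ => ?_
        rw [inner_sub_right (u - _), real_inner_comm (u - _) (runGrad M φ T N x j R θ₁ t)]
        ring
    _ ≤ _ := by linarith

variable [MeasurableSpace S] [DiscreteMeasurableSpace S] {Ω : Type*}
  [MeasurableSpace Ω] {Pr : Measure Ω} [IsProbabilityMeasure Pr] {s : ℕ → Ω → S}
  {J : ℕ → Ω → ℕ} {D : ℕ → ℝ} {K : ℝ} {u : EuclideanSpace ℝ (Fin d)}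

theorem integrable_weightedNormSq_tdAverage [Nonempty S] (hμ : IsStationary M.P μ) (hT : 1 ≤ T)
    (hφ : ∀ a, ‖φ a‖ ≤ 1) (hR : 0 ≤ R) (hθ₁ : ‖θ₁‖ ≤ R) (hN : IsSampleCount T N)
    (hs : ∀ i, Measurable (s i)) (hJ : ∀ t, Measurable (J t)) (hu : ‖u‖ ≤ R) :
    Integrable (fun ω => weightedNormSq μ (fun a => linValue φ u a -
      linValue φ (tdAverage M φ R T N θ₁ (fun i => s i ω) (fun t => J t ω)) a)) Pr :=
  ((isLocal_tdAverage (M := M) (φ := φ) (R := R) (θ₁ := θ₁) hN).comp fun θ => weightedNormSq μ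
    fun a => linValue φ u a - linValue φ θ a).integrable (B := 4 * R ^ 2) (fun j x => by
      rw [abs_of_nonneg (weightedNormSq_nonneg hμ _)]
      exact weightedNormSq_le hμ hφ hu (norm_tdAverage_le hT hR hθ₁ x j)) hs hJ

theorem integral_weightedNormSq_tdAverage_le (hμ : IsStationary M.P μ) (hT : 1 ≤ T)
    (hr : ∀ a b, |M.r a b| ≤ rmax) (hφ : ∀ a, ‖φ a‖ ≤ 1) (hR : 0 < R) (hG : 0 < rmax + 2 * R)
    (hθ₁ : ‖θ₁‖ ≤ R) (hN : IsSampleCount T N) (hs : IsMarkovChain M.P s Pr)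
    (hJ : IsIIDGeomHalf J Pr) (hind : IndepFun (fun ω t => J t ω) (fun ω i => s i ω) Pr)
    (hD : ∀ m x, ∑ y, |(M.P ^ m) x y - μ y| ≤ D m) (hK : ∀ n, ∑ m ∈ Finset.range n, D m ≤ K)
    (hu : ‖u‖ ≤ R) (hfix : meanSemiGrad M μ φ u = 0) :
    (1 - M.γ) * ∫ ω, weightedNormSq μ (fun a => linValue φ u a -
        linValue φ (tdAverage M φ R T N θ₁ (fun i => s i ω) (fun t => J t ω)) a) ∂Pr ≤
      (T : ℝ)⁻¹ * (2 * (√2 * R) * ((rmax + 2 * R) *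
        √(T * (2 + Nat.log 2 T * (48 * (1 + K))))) + 4 * R * (rmax + 2 * R) * K) := by
  obtain ⟨ω₀⟩ := Pr.nonempty_of_neZero
  have : Nonempty S := ⟨s 0 ω₀⟩
  have hT0 : (0 : ℝ) < T := by exact_mod_cast hT
  have hK0 : 0 ≤ K := by simpa using hK 0
  set G := rmax + 2 * R with hGdef
  set v := 2 + Nat.log 2 T * (48 * (1 + K)) with hv
  have hv0 : 0 < v := by positivity
  set b := G * √(T * v) with hb
  have hb0 : 0 < b := by positivity
  have hb2 : b ^ 2 = T * (G ^ 2 * v) := by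
    rw [hb, mul_pow, Real.sq_sqrt (by positivity)]; ring
  have iW := integrable_weightedNormSq_tdAverage (Pr := Pr) hμ hT hφ hR.le hθ₁ hN hs.1 hJ.1 hu
  have iA : ∀ t ∈ Finset.range T, Integrable (fun ω =>
      ‖runGrad M φ T N (fun i => s i ω) (fun t => J t ω) R θ₁ t‖ ^ 2) Pr := fun t _ =>
    ((isLocal_runGrad M φ R θ₁ hN t).comp fun v => ‖v‖ ^ 2).integrable (fun j x => by
      rw [abs_of_nonneg (by positivity)]
      exact norm_sq_runGrad_le_const hT hr hφ hR.le hθ₁ t j x) hs.1 hJ.1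
  have iB : ∀ t ∈ Finset.range T, Integrable (fun ω => inner ℝ
      (u - (tdState M φ R T N θ₁ (fun i => s i ω) (fun t => J t ω) t).θ)
      (runGrad M φ T N (fun i => s i ω) (fun t => J t ω) R θ₁ t - meanSemiGrad M μ φ
        (tdState M φ R T N θ₁ (fun i => s i ω) (fun t => J t ω) t).θ)) Pr := fun t _ => by
    set c := 2 * G ^ 2 + ∑ k ∈ Finset.Icc 1 (Nat.log 2 T),
      (4 * ((2 : ℝ) ^ k) ^ 2 * (G ^ 2 + G ^ 2)) with hc
    refine ((isLocal_runGrad M φ R θ₁ hN t).comp₂ ((isLocal_tdState M φ R θ₁ hN t).mono t.le_succ)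
      fun v st => inner ℝ (u - st.θ) (v - meanSemiGrad M μ φ st.θ)).integrable
      (B := 2 * R * (√c + G)) (fun j x => ?_) hs.1 hJ.1
    have hθ := norm_tdState_le M φ T N x j hR.le hθ₁ t
    refine (abs_real_inner_le_norm _ _).trans (mul_le_mul ?_ ?_ (norm_nonneg _) (by positivity))
    · exact (norm_sub_le _ _).trans (by linarith)
    · refine (norm_sub_le _ _).trans (add_le_add ?_ ?_)
      · exact Real.le_sqrt_of_sq_le (norm_sq_runGrad_le_const hT hr hφ hR.le hθ₁ t j x)
      · exact norm_transitionMean_le M.stochastic hμ (norm_semiGrad_le hr hφ hθ)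
  have iA' := integrable_finsetSum _ iA
  have iB' := integrable_finsetSum _ iB
  have iA'' := ((iA'.div_const b).add (integrable_const b)).const_mul (√2 * R)
  rw [← integral_const_mul]
  refine (integral_mono (iW.const_mul _) ((iA''.sub iB').const_mul (T : ℝ)⁻¹) fun ω =>
    one_sub_mul_weightedNormSq_tdAverage_le hμ hT hR hθ₁ hu hfix hb0 _ _).trans ?_
  rw [integral_const_mul]
  refine mul_le_mul_of_nonneg_left ?_ (by positivity)
  have e1 := integral_sub iA'' iB'
  simp only [Pi.add_apply] at e1
  have e2 := integral_add (iA'.div_const b) (integrable_const b)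
  refine le_trans (le_of_eq e1) ?_
  rw [integral_const_mul, e2, integral_div, integral_finsetSum _ iA, integral_finsetSum _ iB,
    integral_const, probReal_univ, one_smul, sub_eq_add_neg]
  refine add_le_add ?_ ?_
  · have hA : ∑ t ∈ Finset.range T, ∫ ω,
        ‖runGrad M φ T N (fun i => s i ω) (fun t => J t ω) R θ₁ t‖ ^ 2 ∂Pr ≤ b ^ 2 := by
      calc _ ≤ ∑ t ∈ Finset.range T, (G ^ 2 * v) := by
            refine Finset.sum_le_sum fun t _ => ?_
            refine (integral_norm_sq_runGrad_le hμ hT hr hφ hR.le hG.le hθ₁ hN hs hJ hind hD hK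
              t).trans (le_of_eq ?_)
            rw [hv]
            ring
        _ = b ^ 2 := by rw [hb2, Finset.sum_const, Finset.card_range, nsmul_eq_mul]
    have : (∑ t ∈ Finset.range T, ∫ ω,
        ‖runGrad M φ T N (fun i => s i ω) (fun t => J t ω) R θ₁ t‖ ^ 2 ∂Pr) / b ≤ b := by
      rw [div_le_iff₀ hb0, ← sq]; exact hA
    have h5 : 0 < √2 * R := by positivity
    nlinarith
  · rw [← Finset.sum_neg_distrib]
    calc _ ≤ ∑ t ∈ Finset.range T, 4 * R * G * K / T :=
          Finset.sum_le_sum fun t _ => (neg_le_abs _).trans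
            (abs_integral_inner_runGrad_sub_le hμ hT hr hφ hR.le hG.le hθ₁ hN hs hJ hind hD hK hu t)
      _ = 4 * R * G * K := by
          rw [Finset.sum_const, Finset.card_range, nsmul_eq_mul]
          field_simp

end FinalBound

theorem natLog_two_le {T : ℕ} (hT : 1 ≤ T) : (Nat.log 2 T : ℝ) ≤ 2 * Real.log T := by
  have h1 : (2 : ℝ) ^ Nat.log 2 T ≤ T := by
    exact_mod_cast Nat.pow_log_le_self 2 (by omega)
  have h2 := Real.log_le_log (by positivity) h1
  rw [Real.log_pow] at h2
  have h3 := Real.log_two_gt_d9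
  have h4 : (0 : ℝ) ≤ Nat.log 2 T := Nat.cast_nonneg _
  nlinarith

theorem rate_le {G R τ T l L : ℝ} (hG : 0 ≤ G) (hR : 0 ≤ R) (hτ : 1 ≤ τ) (hτT : τ ≤ T)
    (hl : 0 ≤ l) (hL : L ≤ 2 * l) :
    T⁻¹ * (2 * (√2 * R) * (G * √(T * (2 + L * (48 * (1 + 4 * τ))))) + 4 * R * G * (4 * τ)) ≤
      100 * (1 + l) ^ 1 * (G * R * √τ / √T) := by
  have hT0 : 0 < T := by linarith
  have hsT : 0 < √T := Real.sqrt_pos.2 hT0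
  have hTT : √T * √T = T := Real.mul_self_sqrt hT0.le
  have hττ : √τ * √τ = τ := Real.mul_self_sqrt (by linarith)
  have hs : √τ ≤ √T := Real.sqrt_le_sqrt hτT
  have h1 : √(T * (2 + L * (48 * (1 + 4 * τ)))) ≤ 22 * (1 + l) * (√T * √τ) := by
    refine Real.sqrt_le_iff.2 ⟨by positivity, ?_⟩
    have e : (22 * (1 + l) * (√T * √τ)) ^ 2 = T * (484 * (1 + l) ^ 2 * τ) := by
      calc _ = 484 * (1 + l) ^ 2 * ((√T * √T) * (√τ * √τ)) := by ring
        _ = _ := by rw [hTT, hττ]; ring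
    rw [e]
    refine mul_le_mul_of_nonneg_left ?_ hT0.le
    have h2 : L * (48 * (1 + 4 * τ)) ≤ 2 * l * (48 * (5 * τ)) :=
      mul_le_mul hL (by linarith) (by linarith) (by linarith)
    nlinarith [mul_nonneg hl (by linarith : 0 ≤ τ), mul_nonneg (sq_nonneg l) (by linarith : 0 ≤ τ)]
  have h2 : √2 ≤ 1.5 := Real.sqrt_le_iff.2 ⟨by norm_num, by norm_num⟩
  have h3 : √2 * √(T * (2 + L * (48 * (1 + 4 * τ)))) ≤ 1.5 * (22 * (1 + l) * (√T * √τ)) :=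
    mul_le_mul h2 h1 (Real.sqrt_nonneg _) (by norm_num)
  have h4 : τ ≤ (1 + l) * (√T * √τ) := by
    have : √τ * √τ ≤ √T * √τ := mul_le_mul_of_nonneg_right hs (Real.sqrt_nonneg _)
    have h5 : 0 ≤ √T * √τ := by positivity
    nlinarith
  have hGR : 0 ≤ G * R := mul_nonneg hG hR
  rw [inv_mul_le_iff₀ hT0]
  calc _ = 2 * (G * R) * (√2 * √(T * (2 + L * (48 * (1 + 4 * τ))))) + 16 * (G * R) * τ := by ring
    _ ≤ 2 * (G * R) * (1.5 * (22 * (1 + l) * (√T * √τ))) +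
        16 * (G * R) * ((1 + l) * (√T * √τ)) := by gcongr
    _ = 82 * ((G * R) * ((1 + l) * (√T * √τ))) := by ring
    _ ≤ 100 * ((G * R) * ((1 + l) * (√T * √τ))) := by
        have : 0 ≤ (G * R) * ((1 + l) * (√T * √τ)) := by positivity
        linarith
    _ = T * (100 * (1 + l) ^ 1 * (G * R * √τ / √T)) := by
        rw [← mul_left_inj' hsT.ne']
        rw [pow_one]
        field_simp
        rw [sq, hTT]

end MagTD

theorem mainTheorem5 :
    ∃ (C : ℝ) (k : ℕ), 0 < C ∧
      ∀ (S : Type*) [Fintype S] [DecidableEq S] [MeasurableSpace S] [DiscreteMeasurableSpace S]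
        (M : MagTD.MRP S) (μ : S → ℝ) (rmax : ℝ)
        (d : ℕ) (φ : S → EuclideanSpace ℝ (Fin d))
        (θstar θ₁ : EuclideanSpace ℝ (Fin d)) (R : ℝ) (T : ℕ) (N : ℕ → ℕ)
        (Ω : Type*) [MeasurableSpace Ω] (Pr : Measure Ω) [IsProbabilityMeasure Pr]
        (s : ℕ → Ω → S) (J : ℕ → Ω → ℕ),
        M.Ergodic →
        MagTD.IsStationary M.P μ →
        (∀ a b, |M.r a b| ≤ rmax) →
        (∀ a, ‖φ a‖ ≤ 1) →
        MagTD.meanSemiGrad M μ φ θstar = 0 →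
        0 < R → ‖θstar‖ ≤ R → ‖θ₁‖ ≤ R →
        1 ≤ T →
        MagTD.IsSampleCount T N →
        MagTD.IsMarkovChain M.P s Pr →
        MagTD.IsIIDGeomHalf J Pr →
        IndepFun (fun ω t => J t ω) (fun ω i => s i ω) Pr →
        Integrable (fun ω => MagTD.weightedNormSq μ (fun a =>
            MagTD.linValue φ θstar a -
              MagTD.linValue φ
                (MagTD.tdAverage M φ R T N θ₁ (fun i => s i ω) (fun t => J t ω)) a)) Pr ∧
          ∫ ω, MagTD.weightedNormSq μ (fun a =>
            MagTD.linValue φ θstar a -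
              MagTD.linValue φ
                (MagTD.tdAverage M φ R T N θ₁ (fun i => s i ω) (fun t => J t ω)) a) ∂Pr ≤
            C * (1 + Real.log T) ^ k *
              ((rmax + 2 * R) * R * √(MagTD.mixingTime M.P μ : ℝ) / ((1 - M.γ) * √(T : ℝ))) := by
  refine ⟨100, 1, by norm_num, ?_⟩
  intro S _ _ _ _ M μ rmax d φ θstar θ₁ R T N Ω _ Pr _ s J herg hμ hr hφ hfix hR hu hθ₁ hT hN hs
    hJ hind
  obtain ⟨ω₀⟩ := Pr.nonempty_of_neZero
  have : Nonempty S := ⟨s 0 ω₀⟩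
  have hrmax : 0 ≤ rmax := (abs_nonneg _).trans (hr (s 0 ω₀) (s 0 ω₀))
  have hG : 0 < rmax + 2 * R := by linarith
  have hγ : 0 < 1 - M.γ := by linarith [M.γ_lt_one]
  have hγ1 : 1 - M.γ ≤ 1 := by linarith [M.γ_nonneg]
  have hT1 : (1 : ℝ) ≤ T := by exact_mod_cast hT
  have hlog : 0 ≤ Real.log T := Real.log_nonneg hT1
  have hτ : 1 ≤ MagTD.mixingTime M.P μ := (MagTD.mixingTime_spec M.stochastic herg hμ).1
  have hτ1 : (1 : ℝ) ≤ MagTD.mixingTime M.P μ := by exact_mod_cast hτ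
  have hsT : 0 < √(T : ℝ) := Real.sqrt_pos.2 (by linarith)
  refine ⟨MagTD.integrable_weightedNormSq_tdAverage hμ hT hφ hR.le hθ₁ hN hs.1 hJ.1 hu, ?_⟩
  have e : (100 : ℝ) * (1 + Real.log T) ^ 1 *
      ((rmax + 2 * R) * R * √(MagTD.mixingTime M.P μ : ℝ) / ((1 - M.γ) * √(T : ℝ))) =
      100 * (1 + Real.log T) ^ 1 *
      ((rmax + 2 * R) * R * √(MagTD.mixingTime M.P μ : ℝ) / √(T : ℝ)) / (1 - M.γ) := by
    field_simp
  rw [e, le_div_iff₀ hγ, mul_comm]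
  rcases le_total (MagTD.mixingTime M.P μ : ℝ) T with hτT | hτT
  · exact (MagTD.integral_weightedNormSq_tdAverage_le hμ hT hr hφ hR hG hθ₁ hN hs hJ hind
      (MagTD.sum_abs_pow_sub_le M.stochastic herg hμ) (MagTD.sum_half_pow_div_le hτ) hu hfix).trans
      (MagTD.rate_le hG.le hR.le hτ1 hτT hlog (MagTD.natLog_two_le hT))
  · have h1 : ∫ ω, MagTD.weightedNormSq μ (fun a => MagTD.linValue φ θstar a - MagTD.linValue φ
        (MagTD.tdAverage M φ R T N θ₁ (fun i => s i ω) (fun t => J t ω)) a) ∂Pr ≤ 4 * R ^ 2 :=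
      (le_abs_self _).trans (MagTD.abs_integral_le_of_abs_le fun ω => by
        rw [abs_of_nonneg (MagTD.weightedNormSq_nonneg hμ _)]
        exact MagTD.weightedNormSq_le hμ hφ hu (MagTD.norm_tdAverage_le hT hR.le hθ₁ _ _))
    have h0 : 0 ≤ ∫ ω, MagTD.weightedNormSq μ (fun a => MagTD.linValue φ θstar a -
        MagTD.linValue φ
          (MagTD.tdAverage M φ R T N θ₁ (fun i => s i ω) (fun t => J t ω)) a) ∂Pr :=
      integral_nonneg fun ω => MagTD.weightedNormSq_nonneg hμ _
    have h2 : (rmax + 2 * R) * R ≤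
        (rmax + 2 * R) * R * √(MagTD.mixingTime M.P μ : ℝ) / √(T : ℝ) := by
      rw [le_div_iff₀ hsT]
      exact mul_le_mul_of_nonneg_left (Real.sqrt_le_sqrt hτT) (by positivity)
    have h3 : 0 ≤ rmax * R := by positivity
    have h4 : (1 - M.γ) * ∫ ω, MagTD.weightedNormSq μ (fun a => MagTD.linValue φ θstar a -
        MagTD.linValue φ
          (MagTD.tdAverage M φ R T N θ₁ (fun i => s i ω) (fun t => J t ω)) a) ∂Pr ≤ 4 * R ^ 2 :=
      (mul_le_of_le_one_left h0 hγ1).trans h1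
    have h5 : 0 ≤ (rmax + 2 * R) * R := by positivity
    rw [pow_one]
    nlinarith [mul_nonneg hlog (h5.trans h2)]
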